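/- Let $H_0$ be the bounded selfadjoint operator on $\ell^2(\mathbb Z)$ given by $(H_0x)(n)=2x(n)-x(n+1)-x(n-1)$. Let $\mathcal F:\ell^2(\mathbb Z)\to L^2(\mathbb T)$, $(\mathcal Fx)(\vartheta)=(2\pi)^{-1/2}\sum_n e^{-in\vartheta}x(n)$, be the discrete Fourier transform, and let $A_0=\mathcal F^{-1}\widehat A_0\mathcal F$, where $\widehat A_0$ is the unique selfadjoint extension (the closure) of the symmetric operator $\sin\vartheta\,(-i\partial_\vartheta)+(-i\partial_\vartheta)\sin\vartheta$ defined on $C^\infty(\mathbb T)$. For $R>0$ let $\mathcal A_R(A_0)$ be the set of bounded operators $B$ on $\ell^2(\mathbb Z)$ for which the map $\theta\mapsto e^{i\theta A_0}Be^{-i\theta A_0}$, $\theta\in\mathbb R$, extends to a holomorphic map from the disc $\{\theta\in\mathbb C:|\theta|<R\}$ to the bounded operators, and let $\mathcal A(A_0)=\bigcup_{R>0}\mathcal A_R(A_0)$. A vector $\varphi$ is analytic with respect to $A_0$ if it belongs to the domain of $A_0^k$ for every $k$ and $\sum_k \frac{r^k}{k!}\|A_0^k\varphi\|<\infty$ for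 some $r>0$. Let $V$ be a compact operator on $\ell^2(\mathbb Z)$ which belongs to $\mathcal A(A_0)$, and let $H_V=H_0+V$. Then there exists a discrete subset $\mathcal D\subset(0,4)$ whose only possible limit points belong to $\{0,4\}$ and for which the following holds: given any interval $\Delta_0$ with $\overline{\Delta_0}\subset(0,4)\setminus\mathcal D$, there exists $\delta_0>0$ such that every $z$ with $\operatorname{Re}z\in\Delta_0$ and $0<|\operatorname{Im}z|<\delta_0$ lies in the resolvent set of $H_V$, and for any vectors $\varphi,\psi$ analytic with respect to $A_0$, $$\sup_{z\in\Delta_0+i(-\delta_0,0)}|\langle\varphi,(z-H_V)^{-1}\psi\rangle|<\infty,\qquad \sup_{z\in\Delta_0+i(0,\delta_0)}|\langle\varphi,(z-H_V)^{-1}\psi\rangle|<\infty .$$ -/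

import Mathlib

open Set Filter Topology
open scoped ContDiff

namespace DiscreteSchrodinger

noncomputable section

/-- The Hilbert space `ℓ²(ℤ)` of square summable complex sequences. -/
abbrev EllTwo : Type := lp (fun _ : ℤ => ℂ) 2

/-! ### The unperturbed Hamiltonian -/

theorem memlp_shift (k : ℤ) (x : EllTwo) :
    Memℓp (fun n : ℤ => (x (n + k) : ℂ)) 2 := by
  have hx := lp.memℓp x
  rw [memℓp_gen_iff (by norm_num)] at hx ⊢
  exact hx.comp_injective (add_left_injective k)

/-- The shift `(S_k x)(n) = x(n + k)`, as a bounded operator on `ℓ²(ℤ)`. -/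
def shift (k : ℤ) : EllTwo →L[ℂ] EllTwo :=
  LinearMap.mkContinuous
    { toFun := fun x => ⟨fun n => x (n + k), memlp_shift k x⟩
      map_add' := fun _ _ => rfl
      map_smul' := fun _ _ => rfl } 1 (by
    intro x
    rw [one_mul]
    apply le_of_eq
    rw [lp.norm_eq_tsum_rpow (by norm_num), lp.norm_eq_tsum_rpow (by norm_num)]
    congr 1
    exact (Equiv.addRight k).tsum_eq (fun n => ‖(x n : ℂ)‖ ^ (2 : ENNReal).toReal))

@[simp] theorem shift_apply (k : ℤ) (x : EllTwo) (n : ℤ) : shift k x n = x (n + k) := rfl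

/-- The one-dimensional discrete Schrödinger operator
`(H₀ x)(n) = 2 x(n) - x(n + 1) - x(n - 1)`. -/
def H0 : EllTwo →L[ℂ] EllTwo :=
  (2 : ℂ) • ContinuousLinearMap.id ℂ EllTwo - shift 1 - shift (-1)

theorem H0_apply (x : EllTwo) (n : ℤ) : H0 x n = 2 * x n - x (n + 1) - x (n - 1) := rfl

/-! ### The conjugate operator -/

/-- Smooth `2π`-periodic functions, that is, the elements of `C^∞(𝕋)`. -/
def SmoothPeriodic (f : ℝ → ℂ) : Prop :=
  ContDiff ℝ ∞ f ∧ Function.Periodic f (2 * Real.pi)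

/-- The inverse discrete Fourier transform
`(ℱ⁻¹ f)(n) = (2π)^{-1/2} ∫_𝕋 e^{inϑ} f(ϑ) dϑ`. -/
def invFourier (f : ℝ → ℂ) (n : ℤ) : ℂ :=
  ((√(2 * Real.pi))⁻¹ : ℝ) *
    ∫ t in (-Real.pi)..Real.pi, Complex.exp (Complex.I * n * t) * f t

/-- The differential expression `sin ϑ (-i∂_ϑ) + (-i∂_ϑ) sin ϑ`. -/
def torusOp (f : ℝ → ℂ) (t : ℝ) : ℂ :=
  (Real.sin t : ℂ) * (-Complex.I * deriv f t) +
    -Complex.I * deriv (fun s : ℝ => (Real.sin s : ℂ) * f s) t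

theorem SmoothPeriodic.continuous_torusOp {f : ℝ → ℂ} (hf : SmoothPeriodic f) :
    Continuous (torusOp f) := by
  have h1 : Continuous (deriv f) := hf.1.continuous_deriv (by norm_num)
  have hs : ContDiff ℝ ∞ (fun s : ℝ => (Real.sin s : ℂ) * f s) :=
    (Complex.ofRealCLM.contDiff.comp Real.contDiff_sin).mul hf.1
  have h2 := hs.continuous_deriv (by norm_num)
  unfold torusOp
  fun_prop

theorem invFourier_add {f g : ℝ → ℂ} (hf : Continuous f) (hg : Continuous g) (n : ℤ) :
    invFourier (f + g) n = invFourier f n + invFourier g n := by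
  unfold invFourier
  rw [← mul_add, ← intervalIntegral.integral_add]
  · simp only [Pi.add_apply, mul_add]
  · exact Continuous.intervalIntegrable (by fun_prop) _ _
  · exact Continuous.intervalIntegrable (by fun_prop) _ _

theorem invFourier_smul (c : ℂ) (f : ℝ → ℂ) (n : ℤ) :
    invFourier (c • f) n = c * invFourier f n := by
  unfold invFourier
  rw [mul_left_comm, ← intervalIntegral.integral_const_mul c]
  simp only [Pi.smul_apply, smul_eq_mul, mul_left_comm c]

theorem SmoothPeriodic.hasDerivAt_sin_mul {f : ℝ → ℂ} (hf : SmoothPeriodic f) (t : ℝ) :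
    HasDerivAt (fun s : ℝ => (Real.sin s : ℂ) * f s)
      ((Real.cos t : ℂ) * f t + (Real.sin t : ℂ) * deriv f t) t :=
  (Real.hasDerivAt_sin t).ofReal_comp.mul
    (hf.1.differentiable (by norm_num) t).hasDerivAt

theorem torusOp_add {f g : ℝ → ℂ} (hf : SmoothPeriodic f) (hg : SmoothPeriodic g)
    (hfg : SmoothPeriodic (f + g)) : torusOp (f + g) = torusOp f + torusOp g := by
  funext t
  have h : deriv (f + g) t = deriv f t + deriv g t :=
    deriv_add (hf.1.differentiable (by norm_num) t) (hg.1.differentiable (by norm_num) t)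
  simp only [torusOp, Pi.add_apply, hf.hasDerivAt_sin_mul t |>.deriv,
    hg.hasDerivAt_sin_mul t |>.deriv]
  have h2 := (hfg.hasDerivAt_sin_mul t).deriv
  simp only [Pi.add_apply] at h2
  rw [h2, h]
  ring

theorem torusOp_smul (c : ℂ) {f : ℝ → ℂ} (hf : SmoothPeriodic f)
    (hcf : SmoothPeriodic (c • f)) : torusOp (c • f) = c • torusOp f := by
  funext t
  have h : deriv (c • f) t = c • deriv f t :=
    deriv_const_smul c (hf.1.differentiable (by norm_num) t)
  simp only [torusOp, Pi.smul_apply, hf.hasDerivAt_sin_mul t |>.deriv]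
  have h2 := (hcf.hasDerivAt_sin_mul t).deriv
  simp only [Pi.smul_apply] at h2
  rw [h2, h]
  simp only [smul_eq_mul]
  ring

/-- The graph in `ℓ²(ℤ) × ℓ²(ℤ)` of the symmetric operator
`ℱ⁻¹ (sin ϑ (-i∂_ϑ) + (-i∂_ϑ) sin ϑ) ℱ` with domain `ℱ⁻¹ C^∞(𝕋)`. -/
def A0CoreGraph : Submodule ℂ (EllTwo × EllTwo) where
  carrier := {p | ∃ f : ℝ → ℂ, SmoothPeriodic f ∧
    (∀ n, p.1 n = invFourier f n) ∧ (∀ n, p.2 n = invFourier (torusOp f) n)}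
  add_mem' := by
    rintro p q ⟨f, hf, hf1, hf2⟩ ⟨g, hg, hg1, hg2⟩
    have hfg : SmoothPeriodic (f + g) := ⟨hf.1.add hg.1, hf.2.add hg.2⟩
    refine ⟨f + g, hfg, fun n => ?_, fun n => ?_⟩
    · rw [invFourier_add hf.1.continuous hg.1.continuous, ← hf1, ← hg1]; rfl
    · rw [torusOp_add hf hg hfg,
        invFourier_add hf.continuous_torusOp hg.continuous_torusOp, ← hf2, ← hg2]; rfl
  zero_mem' := by
    refine ⟨0, ⟨contDiff_const, fun _ => rfl⟩, fun n => ?_, fun n => ?_⟩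
    · simp [invFourier]
    · simp [invFourier, torusOp]
  smul_mem' := by
    rintro c p ⟨f, hf, hf1, hf2⟩
    have hcf : SmoothPeriodic (c • f) := ⟨contDiff_const.smul hf.1, hf.2.smul c⟩
    refine ⟨c • f, hcf, fun n => ?_, fun n => ?_⟩
    · rw [invFourier_smul, ← hf1]; rfl
    · rw [torusOp_smul c hf hcf, invFourier_smul, ← hf2]; rfl

/-- The conjugate operator `A₀`: the closure of the operator with graph `A0CoreGraph`.
That operator is essentially selfadjoint, so its closure is its unique selfadjoint extension. -/
def A0 : EllTwo →ₗ.[ℂ] EllTwo := A0CoreGraph.topologicalClosure.toLinearPMap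

/-- The matrix of the conjugate operator in the canonical basis. -/
theorem A0CoreGraph_closure_apply {p : EllTwo × EllTwo}
    (hp : p ∈ A0CoreGraph.topologicalClosure) (n : ℤ) :
    p.2 n = Complex.I / 2 * ((2 * n + 1) * p.1 (n + 1) - (2 * n - 1) * p.1 (n - 1)) := by
  have hc : ∀ m : ℤ, Continuous (fun x : EllTwo => (x m : ℂ)) := fun m =>
    (continuous_apply m).comp (lp.uniformContinuous_coe (E := fun _ : ℤ => ℂ) (p := 2)).continuous
  have hclosed : IsClosed {p : EllTwo × EllTwo |
      p.2 n = Complex.I / 2 * ((2 * n + 1) * p.1 (n + 1) - (2 * n - 1) * p.1 (n - 1))} := by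
    have h0 := hc n
    have h1 := hc (n + 1)
    have h2 := hc (n - 1)
    exact isClosed_eq (h0.comp continuous_snd) (((continuous_const.mul
      (h1.comp continuous_fst)).sub (continuous_const.mul (h2.comp continuous_fst))).const_mul _)
  refine closure_minimal ?_ hclosed hp
  rintro ⟨x, y⟩ ⟨f, hf, hx, hy⟩
  simp only at hx hy
  change y n = _ * (_ * x (n + 1) - _ * x (n - 1))
  rw [hx, hx, hy]
  -- the total derivative whose integral vanishes because `sin (± π) = 0`
  set G : ℝ → ℂ := fun t => Complex.exp (Complex.I * n * t) * ((Real.sin t : ℂ) * f t) with hG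
  have hE : ∀ (m : ℤ) (t : ℝ), HasDerivAt (fun t : ℝ => Complex.exp (Complex.I * m * t))
      (Complex.exp (Complex.I * m * t) * (Complex.I * m)) t := by
    intro m t
    have : HasDerivAt (fun t : ℝ => Complex.I * m * (t : ℂ)) (Complex.I * m * 1) t :=
      (Complex.ofRealCLM.hasDerivAt (x := t)).const_mul (Complex.I * m)
    simpa using this.cexp
  have hGd : ∀ t : ℝ, HasDerivAt G
      (Complex.exp (Complex.I * n * t) * (Complex.I * n) * ((Real.sin t : ℂ) * f t) +
        Complex.exp (Complex.I * n * t) *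
          ((Real.cos t : ℂ) * f t + (Real.sin t : ℂ) * deriv f t)) t :=
    fun t => (hE n t).mul (hf.hasDerivAt_sin_mul t)
  have hfc := hf.1.continuous
  have hfd : Continuous (deriv f) := hf.1.continuous_deriv (by norm_num)
  have hGc : Continuous (fun t : ℝ =>
      Complex.exp (Complex.I * n * t) * (Complex.I * n) * ((Real.sin t : ℂ) * f t) +
        Complex.exp (Complex.I * n * t) *
          ((Real.cos t : ℂ) * f t + (Real.sin t : ℂ) * deriv f t)) := by fun_prop
  have hint : ∫ t in (-Real.pi)..Real.pi,
      (Complex.exp (Complex.I * n * t) * (Complex.I * n) * ((Real.sin t : ℂ) * f t) +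
        Complex.exp (Complex.I * n * t) *
          ((Real.cos t : ℂ) * f t + (Real.sin t : ℂ) * deriv f t)) = 0 := by
    rw [intervalIntegral.integral_eq_sub_of_hasDerivAt (fun t _ => hGd t)
      (hGc.intervalIntegrable _ _)]
    simp [hG]
  have key : ∀ t : ℝ, Complex.exp (Complex.I * n * t) * torusOp f t =
      Complex.I / 2 * ((2 * n + 1) * (Complex.exp (Complex.I * (n + 1 : ℤ) * t) * f t) -
        (2 * n - 1) * (Complex.exp (Complex.I * (n - 1 : ℤ) * t) * f t)) +
      (-2 * Complex.I) *
      (Complex.exp (Complex.I * n * t) * (Complex.I * n) * ((Real.sin t : ℂ) * f t) +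
        Complex.exp (Complex.I * n * t) *
          ((Real.cos t : ℂ) * f t + (Real.sin t : ℂ) * deriv f t)) := by
    intro t
    have e1 : Complex.exp (Complex.I * (n + 1 : ℤ) * t) =
        Complex.exp (Complex.I * n * t) * (Real.cos t + Real.sin t * Complex.I) := by
      rw [Complex.ofReal_cos, Complex.ofReal_sin, ← Complex.exp_mul_I, ← Complex.exp_add]
      congr 1; push_cast; ring
    have e2 : Complex.exp (Complex.I * (n - 1 : ℤ) * t) =
        Complex.exp (Complex.I * n * t) * (Real.cos t - Real.sin t * Complex.I) := by
      have : (Real.cos t - Real.sin t * Complex.I : ℂ) = Complex.exp ((-t : ℂ) * Complex.I) := by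
        rw [Complex.exp_mul_I, Complex.cos_neg, Complex.sin_neg, Complex.ofReal_cos,
          Complex.ofReal_sin]
        ring
      rw [this, ← Complex.exp_add]
      congr 1; push_cast; ring
    rw [e1, e2, torusOp, (hf.hasDerivAt_sin_mul t).deriv]
    ring
  have hI : ∀ m : ℤ, IntervalIntegrable
      (fun t : ℝ => Complex.exp (Complex.I * m * t) * f t) MeasureTheory.volume
      (-Real.pi) Real.pi := fun m => Continuous.intervalIntegrable (by fun_prop) _ _
  unfold invFourier
  simp only [key]
  rw [intervalIntegral.integral_add _ ((hGc.intervalIntegrable _ _).const_mul _),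
    intervalIntegral.integral_const_mul, intervalIntegral.integral_const_mul, hint,
    intervalIntegral.integral_sub ((hI _).const_mul _) ((hI _).const_mul _),
    intervalIntegral.integral_const_mul, intervalIntegral.integral_const_mul]
  · ring
  · exact (((hI _).const_mul _).sub ((hI _).const_mul _)).const_mul _

/-- The closure of `A0CoreGraph` is the graph of an operator, so that `A0` is well defined. -/
theorem A0_graph : A0.graph = A0CoreGraph.topologicalClosure := by
  apply Submodule.toLinearPMap_graph_eq
  intro p hp h0
  apply lp.ext
  funext n
  rw [A0CoreGraph_closure_apply hp n, h0]
  simp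

/-! ### Complex scaling with respect to a selfadjoint operator -/

section Scaling

variable {H : Type*} [NormedAddCommGroup H] [InnerProductSpace ℂ H] [CompleteSpace H]

/-- `U θ = e^{iθA}`: the family `U` is the strongly continuous one-parameter unitary group
generated by `A`. For selfadjoint `A` there is exactly one such `U`. -/
structure IsUnitaryGroupOf (A : H →ₗ.[ℂ] H) (U : ℝ → H →L[ℂ] H) : Prop where
  unitary : ∀ s, U s ∈ unitary (H →L[ℂ] H)
  map_zero : U 0 = 1
  map_add : ∀ s t, U (s + t) = U s * U t
  strongly_continuous : ∀ x, Continuous fun s => U s x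
  generator : ∀ x y, (x, y) ∈ A.graph ↔ HasDerivAt (fun s : ℝ => U s x) (Complex.I • y) 0

/-- The class `𝒜_R(A)`: the map `θ ↦ e^{iθA} B e^{-iθA}` extends from real `θ` to a holomorphic
map on the disc `D_R(0)`, with values in the bounded operators. -/
def MemScalingClassRadius (A : H →ₗ.[ℂ] H) (R : ℝ) (B : H →L[ℂ] H) : Prop :=
  ∃ U : ℝ → H →L[ℂ] H, IsUnitaryGroupOf A U ∧
    ∃ F : ℂ → H →L[ℂ] H, DifferentiableOn ℂ F (Metric.ball 0 R) ∧
      ∀ θ : ℝ, |θ| < R → F θ = U θ * B * U (-θ)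

/-- The class `𝒜(A) = ⋃_{R > 0} 𝒜_R(A)`. -/
def MemScalingClass (A : H →ₗ.[ℂ] H) (B : H →L[ℂ] H) : Prop :=
  ∃ R : ℝ, 0 < R ∧ MemScalingClassRadius A R B

/-- `φ` is an analytic vector for `A`: it lies in the domain of every power of `A`
(here `v k = A^k φ`), and `∑ r^k / k! ‖A^k φ‖` converges for some `r > 0`. -/
def IsAnalyticVector (A : H →ₗ.[ℂ] H) (φ : H) : Prop :=
  ∃ v : ℕ → H, v 0 = φ ∧ (∀ k, (v k, v (k + 1)) ∈ A.graph) ∧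
    ∃ r : ℝ, 0 < r ∧ Summable fun k : ℕ => r ^ k / (k.factorial : ℝ) * ‖v k‖

end Scaling

end

end DiscreteSchrodinger

/-!
The proof is the complex scaling argument of Aguilar, Balslev and Combes.

The group `e^{iθA₀}` acts on the multiplication operator `C = cos ϑ` by Möbius transformations,
because `[A₀, C] = 2i (1 - C²)` (`cosOp_mul_group`). Hence `e^{iθA₀} H₀ e^{-iθA₀}` continues to
complex `θ` as an explicit fractional linear function `scaledH0 θ` of `H₀`, whose spectrum for
small `Im θ ≠ 0` is an arc of a circle through `0` and `4`, away from the interval `(0, 4)`. By hypothesis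
`V` has such a continuation too, with compact values, so `H_V` extends to a holomorphic family
`scaledH F θ`.

For a fixed small imaginary `θ` the analytic Fredholm theorem
(`eventually_isUnit_sub_of_isPreconnected`) in the variable `z` shows that the points of `(0, 4)`
where `z - scaledH F θ` is not invertible can only accumulate at `0` and `4`. These points, for
one parameter `θ` in each half plane, form the set `𝒟`.

The same theorem in the variable `θ`, for fixed `z`, shows that invertibility of
`z - scaledH F θ` does not depend on `θ`: the exceptional `θ` are isolated unless they fill the
domain, yet they are invariant under real translations, which act by unitary conjugation
(`isUnit_sub_scaledH_of_mem`). Comparing with `θ = 0` excludes non-real spectrum of `H_V` close to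
compact parts of `(0, 4) \ 𝒟`. Comparing with smaller `θ` makes `𝒟` independent of the vectors:
if `φ` and `ψ` are analytic, their matrix element of the resolvent equals, by the identity
theorem, one of `(z - scaledH F θ)⁻¹` for some small imaginary `θ` (`inner_resolvent_eq`), and this
operator is norm continuous in `z` up to the real axis, hence bounded on compact rectangles.
-/

/-! ### Analytic Fredholm theory -/

section AnalyticFredholm

variable {H : Type*} [NormedAddCommGroup H] [InnerProductSpace ℂ H]

theorem IsCompactOperator.exists_norm_starProjection_comp_sub_lt {K : H →L[ℂ] H}
    (hK : IsCompactOperator K) {ε : ℝ} (hε : 0 < ε) :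
    ∃ E : Submodule ℂ H, ∃ _ : FiniteDimensional ℂ E,
      ‖E.starProjection ∘L K - K‖ < ε := by
  have hT : TotallyBounded (K '' Metric.closedBall 0 1) :=
    (IsCompactOperator.isCompact_closure_image_closedBall (f := (K : H →ₗ[ℂ] H)) hK
      1).totallyBounded.subset subset_closure
  obtain ⟨t, ht, hcov⟩ := Metric.totallyBounded_iff.1 hT (ε / 2) (half_pos hε)
  have hfin : FiniteDimensional ℂ (Submodule.span ℂ t) := FiniteDimensional.span_of_finite ℂ ht
  refine ⟨Submodule.span ℂ t, hfin, ?_⟩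
  refine lt_of_le_of_lt (ContinuousLinearMap.opNorm_le_of_unit_norm (C := ε / 2) (half_pos hε).le
    fun x hx => ?_) (half_lt_self hε)
  obtain ⟨y, hy, hxy⟩ := mem_iUnion₂.1 (hcov ⟨x, by simp [hx], rfl⟩)
  rw [sub_apply, ContinuousLinearMap.comp_apply, norm_sub_rev]
  rw [Submodule.starProjection_minimal]
  refine (ciInf_le ⟨0, ?_⟩ (⟨y, Submodule.subset_span hy⟩ : Submodule.span ℂ t)).trans ?_
  · rintro _ ⟨w, rfl⟩
    exact norm_nonneg _
  · rw [← dist_eq_norm]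
    exact (Metric.mem_ball.1 hxy).le

/-- Sylvester's identity for units: `1 - ba` is invertible as soon as `1 - ab` is, for operators
between different spaces. -/
theorem ContinuousLinearMap.isUnit_one_sub_comp_comm {E F : Type*} [NormedAddCommGroup E]
    [NormedSpace ℂ E] [NormedAddCommGroup F] [NormedSpace ℂ F] (a : E →L[ℂ] F) (b : F →L[ℂ] E)
    (h : IsUnit (1 - a ∘L b)) : IsUnit (1 - b ∘L a) := by
  obtain ⟨u, hu⟩ := h
  have h1 : ∀ x, (↑u⁻¹ : F →L[ℂ] F) x - a (b ((↑u⁻¹ : F →L[ℂ] F) x)) = x := fun x => by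
    have := DFunLike.congr_fun u.mul_inv x
    rw [hu] at this
    simpa using this
  have h2 : ∀ x, (↑u⁻¹ : F →L[ℂ] F) (a (b x)) = (↑u⁻¹ : F →L[ℂ] F) x - x := fun x => by
    have := DFunLike.congr_fun u.inv_mul x
    rw [hu] at this
    simp only [mul_apply_eq_comp, sub_apply,
      one_apply_eq_self, ContinuousLinearMap.comp_apply, map_sub] at this
    rw [eq_sub_iff_add_eq, ← sub_eq_iff_eq_add'.1 this]
  have h3 : ∀ x, a (b ((↑u⁻¹ : F →L[ℂ] F) x)) = (↑u⁻¹ : F →L[ℂ] F) x - x := fun x => by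
    rw [eq_sub_iff_add_eq, ← sub_eq_iff_eq_add'.1 (h1 x)]
  refine isUnit_iff_exists.2 ⟨1 + b ∘L (↑u⁻¹ : F →L[ℂ] F) ∘L a, ?_, ?_⟩ <;> ext x
  · simp [h3]
  · simp [h2]

theorem differentiableAt_det {E : Type*} [NormedAddCommGroup E] [NormedSpace ℂ E]
    [FiniteDimensional ℂ E] {T : ℂ → E →L[ℂ] E} {z : ℂ} (hT : DifferentiableAt ℂ T z) :
    DifferentiableAt ℂ (fun w => LinearMap.det (T w : E →ₗ[ℂ] E)) z := by
  classical
  let b := Module.finBasis ℂ E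
  have h : ∀ w, LinearMap.det (T w : E →ₗ[ℂ] E) =
      ∑ σ : Equiv.Perm _, Equiv.Perm.sign σ •
        ∏ i, LinearMap.toContinuousLinearMap (b.coord (σ i)) (T w (b i)) := fun w => by
    rw [← LinearMap.det_toMatrix b, Matrix.det_apply]
    simp [LinearMap.toMatrix_apply]
  simp only [h, Units.smul_def, zsmul_eq_mul]
  fun_prop

variable [CompleteSpace H]

/-- Near each point, `1 - K(z)` with `K` holomorphic and compact-valued is either invertible on a
punctured neighbourhood or nowhere invertible: up to an invertible factor it is a finite rank
perturbation of the identity, so that invertibility is the non-vanishing of a holomorphic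
determinant. -/
theorem eventually_isUnit_one_sub_or {K : ℂ → H →L[ℂ] H} {z₀ : ℂ}
    (hd : ∀ᶠ z in 𝓝 z₀, DifferentiableAt ℂ K z) (hc : IsCompactOperator (K z₀)) :
    (∀ᶠ z in 𝓝[≠] z₀, IsUnit (1 - K z)) ∨ (∀ᶠ z in 𝓝 z₀, ¬ IsUnit (1 - K z)) := by
  obtain ⟨E, hE, hlt⟩ := hc.exists_norm_starProjection_comp_sub_lt one_pos
  set F : H →L[ℂ] H := E.starProjection ∘L K z₀ with hF
  let L : ℂ → H →L[ℂ] H := fun z => 1 - (K z - F)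
  let G : ℂ → H →L[ℂ] E := fun z =>
    E.orthogonalProjectionOnto ∘L (K z₀ * Ring.inverse (L z))
  let T : ℂ → E →L[ℂ] E := fun z => 1 - G z ∘L E.subtypeL
  have hLd : ∀ᶠ z in 𝓝 z₀, DifferentiableAt ℂ L z :=
    hd.mono fun z hz => (differentiableAt_const _).sub (hz.sub_const _)
  have hLu : ∀ᶠ z in 𝓝 z₀, IsUnit (L z) := by
    have hcont : ContinuousAt K z₀ := hd.self_of_nhds.continuousAt
    have : ∀ᶠ z in 𝓝 z₀, ‖K z - F‖ < 1 := by
      refine (hcont.sub continuousAt_const).norm.eventually_lt continuousAt_const ?_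
      simpa only [Pi.sub_apply, norm_sub_rev] using hlt
    exact this.mono fun z hz => isUnit_one_sub_of_norm_lt_one hz
  have hTd : ∀ᶠ z in 𝓝 z₀, DifferentiableAt ℂ T z := by
    filter_upwards [hLd, hLu] with z hz hu
    have h1 : DifferentiableAt ℂ (fun z => Ring.inverse (L z)) z :=
      (differentiableAt_inverse hu).comp z hz
    have h2 : DifferentiableAt ℂ (fun z => K z₀ * Ring.inverse (L z)) z :=
      (differentiableAt_const _).mul h1
    have h3 : DifferentiableAt ℂ G z := (differentiableAt_const _).clm_comp h2
    exact (differentiableAt_const _).sub (h3.clm_comp (differentiableAt_const _))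
  have hiff : ∀ᶠ z in 𝓝 z₀, (IsUnit (1 - K z) ↔ LinearMap.det (T z : E →ₗ[ℂ] E) ≠ 0) := by
    filter_upwards [hLu] with z hu
    have e1 : (1 - E.subtypeL ∘L G z) * L z = 1 - K z := by
      have : E.subtypeL ∘L G z = F * Ring.inverse (L z) := rfl
      rw [this, sub_mul, mul_assoc, Ring.inverse_mul_cancel _ hu]
      simp only [L, one_mul, mul_one]
      abel
    have e2 : IsUnit (1 - K z) ↔ IsUnit (1 - E.subtypeL ∘L G z) := by
      rw [← e1]
      exact ⟨fun h => (hu.mul_right_iff).1 h, fun h => h.mul hu⟩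
    have e3 : IsUnit (T z) ↔ IsUnit (LinearMap.det (T z : E →ₗ[ℂ] E)) := by
      rw [← LinearMap.isUnit_iff_isUnit_det]
      exact (isUnit_map_iff (Module.End.toContinuousLinearMap (𝕜 := ℂ) E).symm (T z)).symm
    rw [e2, ← isUnit_iff_ne_zero, ← e3]
    exact ⟨ContinuousLinearMap.isUnit_one_sub_comp_comm _ _,
      ContinuousLinearMap.isUnit_one_sub_comp_comm _ _⟩
  have han : AnalyticAt ℂ (fun z => LinearMap.det (T z : E →ₗ[ℂ] E)) z₀ :=
    Complex.analyticAt_iff_eventually_differentiableAt.2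
      (hTd.mono fun z hz => differentiableAt_det hz)
  rcases han.eventually_eq_zero_or_eventually_ne_zero with h | h
  · right
    filter_upwards [h, hiff] with z hz hi
    rw [hi, not_not, hz]
  · left
    filter_upwards [h, hiff.filter_mono nhdsWithin_le_nhds] with z hz hi
    rwa [hi]

/-- The analytic Fredholm theorem: the points of a connected open set at which `A(z) - K(z)` is
not invertible do not accumulate in that set, once `A(z) - K(z)` is invertible somewhere. Here `A`
and `K` are holomorphic, the values of `A` are invertible and those of `K` are compact. -/
theorem eventually_isUnit_sub_of_isPreconnected {S : Set ℂ} (hS : IsOpen S)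
    (hconn : IsPreconnected S) {A K : ℂ → H →L[ℂ] H} (hA : DifferentiableOn ℂ A S)
    (hAu : ∀ z ∈ S, IsUnit (A z)) (hK : DifferentiableOn ℂ K S)
    (hc : ∀ z ∈ S, IsCompactOperator (K z)) {w : ℂ} (hw : w ∈ S) (hwu : IsUnit (A w - K w))
    {z : ℂ} (hz : z ∈ S) : ∀ᶠ y in 𝓝[≠] z, IsUnit (A y - K y) := by
  let M : ℂ → H →L[ℂ] H := fun z => Ring.inverse (A z) * K z
  have hM : ∀ z ∈ S, (IsUnit (A z - K z) ↔ IsUnit (1 - M z)) := fun z hz => by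
    have : A z - K z = A z * (1 - M z) := by
      rw [mul_sub, mul_one, ← mul_assoc, Ring.mul_inverse_cancel _ (hAu z hz), one_mul]
    rw [this]
    exact ⟨fun h => ((hAu z hz).mul_left_iff).1 h, fun h => (hAu z hz).mul h⟩
  have hmem : ∀ z ∈ S, ∀ᶠ y in 𝓝 z, y ∈ S := fun z hz => hS.mem_nhds hz
  have hloc : ∀ z ∈ S, (∀ᶠ y in 𝓝[≠] z, IsUnit (A y - K y)) ∨
      (∀ᶠ y in 𝓝 z, ¬ IsUnit (A y - K y)) := fun z hz => by
    have hd : ∀ᶠ y in 𝓝 z, DifferentiableAt ℂ M y := (hmem z hz).mono fun y hy =>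
      ((differentiableAt_inverse (hAu y hy)).comp y (hA.differentiableAt (hS.mem_nhds hy))).mul
        (hK.differentiableAt (hS.mem_nhds hy))
    have hMc : IsCompactOperator (M z) := (hc z hz).clm_comp (Ring.inverse (A z))
    refine (eventually_isUnit_one_sub_or hd hMc).imp (fun h => ?_) fun h => ?_
    · filter_upwards [h, (hmem z hz).filter_mono nhdsWithin_le_nhds] with y hy hyS
      exact (hM y hyS).2 hy
    · filter_upwards [h, hmem z hz] with y hy hyS
      rwa [hM y hyS]
  rcases hloc z hz with h | h
  · exact h
  exfalso
  -- the two alternatives define disjoint open sets covering `S`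
  obtain ⟨x, -, hx1, hx2⟩ := hconn
    {z | ∀ᶠ y in 𝓝 z, ¬ IsUnit (A y - K y)}
    (interior {z | IsUnit (A z - K z) ∨ ∀ᶠ y in 𝓝[≠] z, IsUnit (A y - K y)})
    isOpen_setOfPred_eventually_nhds isOpen_interior (fun x hx => by
      rcases hloc x hx with h1 | h1
      · right
        rw [mem_interior_iff_mem_nhds]
        have : ∀ᶠ y in 𝓝 x, y ≠ x → IsUnit (A y - K y) := eventually_nhdsWithin_iff.1 h1
        refine this.mono fun y hy => ?_
        by_cases hyx : y = x
        · subst hyx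
          exact Or.inr h1
        · exact Or.inl (hy hyx)
      · exact Or.inl h1)
    ⟨z, hz, h⟩ ⟨w, hw, by
      rw [mem_interior_iff_mem_nhds]
      have hcont : ContinuousAt (fun z => A z - K z) w :=
        (hA.differentiableAt (hS.mem_nhds hw)).continuousAt.sub
          (hK.differentiableAt (hS.mem_nhds hw)).continuousAt
      exact (hcont.eventually (Units.isOpen.mem_nhds hwu)).mono fun y hy => Or.inl hy⟩
  rcases interior_subset hx2 with h1 | h1
  · exact hx1.self_of_nhds h1
  · obtain ⟨y, hy1, hy2⟩ := (h1.and (hx1.filter_mono nhdsWithin_le_nhds)).exists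
    exact hy2 hy1

end AnalyticFredholm

/-! ### Holomorphic continuation from the real axis -/

/-- The identity theorem for functions which agree on a one-sided real neighbourhood of a real
point. -/
theorem eqOn_of_eventuallyEq_ofReal {E : Type*} [NormedAddCommGroup E] [NormedSpace ℂ E]
    [CompleteSpace E] {S : Set ℂ} (hS : IsOpen S) (hconn : IsPreconnected S) {f g : ℂ → E}
    (hf : DifferentiableOn ℂ f S) (hg : DifferentiableOn ℂ g S) {x₀ : ℝ} (hx₀ : (x₀ : ℂ) ∈ S)
    (h : ∀ᶠ x : ℝ in 𝓝[>] x₀, f x = g x) : EqOn f g S := by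
  refine (hf.analyticOnNhd hS).eqOn_of_preconnected_of_frequently_eq (hg.analyticOnNhd hS)
    hconn hx₀ ?_
  have ht : Tendsto (fun x : ℝ => (x : ℂ)) (𝓝[>] x₀) (𝓝[≠] (x₀ : ℂ)) := by
    refine tendsto_nhdsWithin_iff.2 ⟨Complex.continuous_ofReal.continuousAt.tendsto.mono_left
      nhdsWithin_le_nhds, eventually_mem_nhdsWithin.mono fun x hx => ?_⟩
    simpa using (ne_of_gt hx)
  exact ht.frequently h.frequently

/-- A holomorphic function whose values on the real axis lie in a closed subspace takes all its
values there. -/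
theorem mem_of_eventually_ofReal_mem {E : Type*} [NormedAddCommGroup E] [NormedSpace ℂ E]
    [CompleteSpace E] {S : Set ℂ} (hS : IsOpen S) (hconn : IsPreconnected S) {f : ℂ → E}
    (hf : DifferentiableOn ℂ f S) {x₀ : ℝ} (hx₀ : (x₀ : ℂ) ∈ S) {N : Submodule ℂ E}
    (hN : IsClosed (N : Set E)) (h : ∀ᶠ x : ℝ in 𝓝[>] x₀, f x ∈ N) {z : ℂ} (hz : z ∈ S) :
    f z ∈ N := by
  have : IsClosed (N : Set E) := hN
  have h0 : EqOn (fun z => N.mkQL (f z)) (fun _ => 0) S :=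
    eqOn_of_eventuallyEq_ofReal hS hconn (N.mkQL.differentiable.comp_differentiableOn hf)
      (differentiableOn_const 0) hx₀ (h.mono fun x hx => (Submodule.Quotient.mk_eq_zero N).2 hx)
  exact (Submodule.Quotient.mk_eq_zero N).1 (h0 hz)

/-! ### Exponential series -/

/-- The exponential generating series `∑ θᵏ / k! • v k` of a sequence of vectors. -/
noncomputable def expSeries {E : Type*} [NormedAddCommGroup E] [NormedSpace ℂ E] (v : ℕ → E)
    (θ : ℂ) : E :=
  ∑' k : ℕ, (θ ^ k / (k.factorial : ℂ)) • v k

section ExpSeries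

variable {E : Type*} [NormedAddCommGroup E] [NormedSpace ℂ E] {v : ℕ → E} {r : ℝ}

theorem norm_expSeries_term_le {θ : ℂ} (hθ : ‖θ‖ ≤ r) (k : ℕ) :
    ‖(θ ^ k / (k.factorial : ℂ)) • v k‖ ≤ r ^ k / (k.factorial : ℝ) * ‖v k‖ := by
  rw [norm_smul, norm_div, norm_pow, Complex.norm_natCast]
  gcongr

variable [CompleteSpace E]

theorem hasSum_expSeries (hv : Summable fun k : ℕ => r ^ k / (k.factorial : ℝ) * ‖v k‖) {θ : ℂ}
    (hθ : ‖θ‖ ≤ r) :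
    HasSum (fun k : ℕ => (θ ^ k / (k.factorial : ℂ)) • v k) (expSeries v θ) :=
  (Summable.of_norm_bounded hv (norm_expSeries_term_le hθ)).hasSum

theorem differentiableOn_expSeries
    (hv : Summable fun k : ℕ => r ^ k / (k.factorial : ℝ) * ‖v k‖) :
    DifferentiableOn ℂ (expSeries v) (Metric.ball 0 r) :=
  Complex.differentiableOn_tsum_of_summable_norm hv (fun k => by fun_prop) Metric.isOpen_ball
    fun k θ hθ => norm_expSeries_term_le (mem_ball_zero_iff.1 hθ).le k

end ExpSeries

namespace DiscreteSchrodinger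

/-! ### Unitary groups and analytic vectors -/

section UnitaryGroup

variable {H : Type*} [NormedAddCommGroup H] [InnerProductSpace ℂ H] [CompleteSpace H]
  {A : H →ₗ.[ℂ] H} {U : ℝ → H →L[ℂ] H}

namespace IsUnitaryGroupOf

theorem mul_neg (hU : IsUnitaryGroupOf A U) (s : ℝ) : U s * U (-s) = 1 := by
  rw [← hU.map_add, add_neg_cancel, hU.map_zero]

theorem neg_mul (hU : IsUnitaryGroupOf A U) (s : ℝ) : U (-s) * U s = 1 := by
  rw [← hU.map_add, neg_add_cancel, hU.map_zero]

theorem neg_apply_apply (hU : IsUnitaryGroupOf A U) (s : ℝ) (x : H) : U (-s) (U s x) = x :=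
  DFunLike.congr_fun (hU.neg_mul s) x

theorem norm_apply (hU : IsUnitaryGroupOf A U) (s : ℝ) (x : H) : ‖U s x‖ = ‖x‖ :=
  ContinuousLinearMap.norm_map_of_mem_unitary (hU.unitary s) x

theorem inner_apply (hU : IsUnitaryGroupOf A U) (s : ℝ) (x y : H) :
    inner ℂ (U s x) (U s y) = inner ℂ x y :=
  ContinuousLinearMap.inner_map_map_of_mem_unitary (hU.unitary s) x y

theorem isUnit (hU : IsUnitaryGroupOf A U) (s : ℝ) : IsUnit (U s) :=
  isUnit_iff_exists.2 ⟨U (-s), hU.mul_neg s, hU.neg_mul s⟩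

theorem hasDerivAt (hU : IsUnitaryGroupOf A U) {x y : H} (h : (x, y) ∈ A.graph) (s : ℝ) :
    HasDerivAt (fun t : ℝ => U t x) (Complex.I • U s y) s := by
  have h0 : HasDerivAt (fun t : ℝ => U t x) (Complex.I • y) (s - s) := by
    simpa using (hU.generator x y).1 h
  have h1 := h0.comp_sub_const s s
  have h2 := (((U s).restrictScalars ℝ).hasFDerivAt).comp_hasDerivAt s h1
  have e : (fun t : ℝ => U t x) = fun t : ℝ => U s (U (t - s) x) := by
    funext t
    rw [← mul_apply_eq_comp, ← hU.map_add, add_sub_cancel]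
  rw [e]
  simp only [ContinuousLinearMap.coe_restrictScalars', map_smul] at h2
  exact h2

theorem apply_mem_graph (hU : IsUnitaryGroupOf A U) {x y : H} (h : (x, y) ∈ A.graph) (s : ℝ) :
    (U s x, U s y) ∈ A.graph := by
  rw [hU.generator]
  have h2 := (((U s).restrictScalars ℝ).hasFDerivAt).comp_hasDerivAt 0 ((hU.generator x y).1 h)
  have e : (fun t : ℝ => U t (U s x)) = fun t : ℝ => U s (U t x) := by
    funext t
    rw [← mul_apply_eq_comp, ← mul_apply_eq_comp, ← hU.map_add, ← hU.map_add, add_comm]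
  rw [e]
  simp only [ContinuousLinearMap.coe_restrictScalars', map_smul] at h2
  exact h2

/-- Taylor's formula with remainder for the orbit of a vector in the domains of the powers of the
generator. -/
theorem norm_sub_taylor_le (hU : IsUnitaryGroupOf A U) {v : ℕ → H}
    (hv : ∀ k, (v k, v (k + 1)) ∈ A.graph) (n : ℕ) : ∀ (k : ℕ) {t : ℝ}, 0 ≤ t →
    ‖U t (v k) - ∑ j ∈ Finset.range n, ((Complex.I * t) ^ j / (j.factorial : ℂ)) • v (k + j)‖ ≤
      t ^ n / (n.factorial : ℝ) * ‖v (k + n)‖ := by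
  induction n with
  | zero => intro k t _; simp [hU.norm_apply]
  | succ n ih =>
    intro k t ht
    have hsum : ∀ s : ℝ, HasDerivAt (fun s : ℝ => ∑ j ∈ Finset.range (n + 1),
        ((Complex.I * s) ^ j / (j.factorial : ℂ)) • v (k + j))
        (Complex.I • ∑ j ∈ Finset.range n,
          ((Complex.I * s) ^ j / (j.factorial : ℂ)) • v (k + 1 + j)) s := fun s => by
      simp only [Finset.sum_range_succ', Finset.smul_sum, smul_smul]
      simp only [pow_zero, add_zero]
      refine HasDerivAt.add_const _ (HasDerivAt.fun_sum fun j _ => ?_)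
      have h1 : HasDerivAt (fun s : ℝ => Complex.I * (s : ℂ)) (Complex.I * 1) s :=
        (Complex.ofRealCLM.hasDerivAt (x := s)).const_mul Complex.I
      have h2 := ((h1.fun_pow (j + 1)).div_const ((j + 1).factorial : ℂ)).smul_const (v (k + (j + 1)))
      refine h2.congr_deriv ?_
      rw [show k + 1 + j = k + (j + 1) by ring]
      congr 1
      have : ((j.factorial : ℕ) : ℂ) ≠ 0 := by exact_mod_cast j.factorial_ne_zero
      have : ((j : ℂ) + 1) ≠ 0 := by exact_mod_cast j.succ_ne_zero
      rw [Nat.factorial_succ]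
      push_cast
      field_simp
    have hd : ∀ s : ℝ, HasDerivAt (fun s : ℝ => U s (v k) - ∑ j ∈ Finset.range (n + 1),
        ((Complex.I * s) ^ j / (j.factorial : ℂ)) • v (k + j))
        (Complex.I • (U s (v (k + 1)) - ∑ j ∈ Finset.range n,
          ((Complex.I * s) ^ j / (j.factorial : ℂ)) • v (k + 1 + j))) s := fun s => by
      rw [smul_sub]
      exact (hU.hasDerivAt (hv k) s).sub (hsum s)
    have hB : ∀ s : ℝ, HasDerivAt
        (fun s : ℝ => s ^ (n + 1) / ((n + 1).factorial : ℝ) * ‖v (k + (n + 1))‖)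
        (s ^ n / (n.factorial : ℝ) * ‖v (k + (n + 1))‖) s := fun s => by
      have h2 := (((hasDerivAt_id' s).fun_pow (n + 1)).div_const
        ((n + 1).factorial : ℝ)).mul_const ‖v (k + (n + 1))‖
      refine h2.congr_deriv ?_
      congr 1
      have : ((n.factorial : ℕ) : ℝ) ≠ 0 := by exact_mod_cast n.factorial_ne_zero
      have : ((n : ℝ) + 1) ≠ 0 := by positivity
      rw [Nat.factorial_succ]
      push_cast
      field_simp
    refine image_norm_le_of_norm_deriv_right_le_deriv_boundary (a := 0) (b := t)
      (fun s _ => (hd s).continuousAt.continuousWithinAt) (fun s _ => (hd s).hasDerivWithinAt)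
      ?_ (fun s => hB s) (fun s hs => ?_) ⟨ht, le_rfl⟩
    · simp [Finset.sum_range_succ', hU.map_zero]
    · rw [norm_smul, Complex.norm_I, one_mul]
      have := ih (k + 1) hs.1
      rwa [show k + 1 + n = k + (n + 1) by ring] at this

/-- The orbit of an analytic vector is given by its exponential series. -/
theorem apply_eq_expSeries (hU : IsUnitaryGroupOf A U) {v : ℕ → H}
    (hv : ∀ k, (v k, v (k + 1)) ∈ A.graph) {r : ℝ}
    (hr : Summable fun k : ℕ => r ^ k / (k.factorial : ℝ) * ‖v k‖) {t : ℝ} (ht : 0 ≤ t)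
    (htr : t ≤ r) : U t (v 0) = expSeries v (Complex.I * t) := by
  have hn : ‖Complex.I * (t : ℂ)‖ ≤ r := by simpa [abs_of_nonneg ht] using htr
  refine tendsto_nhds_unique ?_ (hasSum_expSeries hr hn).tendsto_sum_nat
  rw [tendsto_iff_norm_sub_tendsto_zero]
  refine squeeze_zero (fun n => norm_nonneg _) (fun n => ?_) hr.tendsto_atTop_zero
  have := hU.norm_sub_taylor_le hv n 0 ht
  simp only [zero_add] at this
  rw [norm_sub_rev]
  exact this.trans (by gcongr)

end IsUnitaryGroupOf

end UnitaryGroup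

/-! ### The operator `cos ϑ` and its commutator with the conjugate operator -/

/-- The operator of multiplication by `cos ϑ` in the Fourier representation,
`(C x)(n) = (x(n + 1) + x(n - 1)) / 2`. -/
noncomputable def cosOp : EllTwo →L[ℂ] EllTwo := (1 / 2 : ℂ) • (shift 1 + shift (-1))

theorem cosOp_apply (x : EllTwo) (n : ℤ) : cosOp x n = (x (n + 1) + x (n - 1)) / 2 := by
  change (1 / 2 : ℂ) * (x (n + 1) + x (n + -1)) = _
  rw [← sub_eq_add_neg]
  ring

theorem H0_eq_cosOp : H0 = (2 : ℂ) • (1 : EllTwo →L[ℂ] EllTwo) - (2 : ℂ) • cosOp := by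
  rw [H0, cosOp, smul_smul]
  norm_num [sub_sub]
  rfl

theorem norm_shift_le (k : ℤ) : ‖shift k‖ ≤ 1 :=
  LinearMap.mkContinuous_norm_le _ zero_le_one _

theorem norm_cosOp_le : ‖cosOp‖ ≤ 1 := by
  rw [cosOp, norm_smul]
  have := norm_add_le_of_le (norm_shift_le 1) (norm_shift_le (-1))
  norm_num at this ⊢
  linarith

theorem inner_shift_left (k : ℤ) (x y : EllTwo) :
    inner ℂ (shift k x) y = inner ℂ x (shift (-k) y) := by
  rw [lp.inner_eq_tsum, lp.inner_eq_tsum, ← (Equiv.addRight k).tsum_eq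
    (fun n => inner ℂ (x n) (shift (-k) y n))]
  simp [shift_apply]

theorem isSelfAdjoint_cosOp : IsSelfAdjoint cosOp := by
  rw [ContinuousLinearMap.isSelfAdjoint_iff_isSymmetric]
  intro x y
  simp only [cosOp, ContinuousLinearMap.coe_coe, smul_apply, add_apply,
    inner_smul_left, inner_smul_right, inner_add_left, inner_add_right, inner_shift_left]
  simp only [neg_neg, map_div₀, map_one, map_ofNat]
  ring

theorem smoothPeriodic_cos_mul {f : ℝ → ℂ} (hf : SmoothPeriodic f) :
    SmoothPeriodic (fun t => (Real.cos t : ℂ) * f t) := by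
  refine ⟨(Complex.ofRealCLM.contDiff.comp Real.contDiff_cos).mul hf.1, fun t => ?_⟩
  simp only [Real.cos_add_two_pi, hf.2 t]

theorem exp_I_mul_int_mul (n : ℤ) (t : ℝ) :
    (Complex.exp (Complex.I * (n + 1 : ℤ) * t) + Complex.exp (Complex.I * (n - 1 : ℤ) * t)) / 2 =
      Complex.exp (Complex.I * n * t) * (Real.cos t : ℂ) := by
  rw [Complex.ofReal_cos, Complex.cos, mul_div_assoc', mul_add, ← Complex.exp_add,
    ← Complex.exp_add]
  congr 3 <;> push_cast <;> ring

theorem invFourier_cos_mul {f : ℝ → ℂ} (hf : Continuous f) (n : ℤ) :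
    invFourier (fun t => (Real.cos t : ℂ) * f t) n =
      (invFourier f (n + 1) + invFourier f (n - 1)) / 2 := by
  have hI : ∀ m : ℤ, IntervalIntegrable
      (fun t : ℝ => Complex.exp (Complex.I * m * t) * f t) MeasureTheory.volume
      (-Real.pi) Real.pi := fun m => Continuous.intervalIntegrable (by fun_prop) _ _
  unfold invFourier
  rw [← mul_add, ← intervalIntegral.integral_add (hI _) (hI _), mul_div_assoc,
    ← intervalIntegral.integral_div]
  congr 2
  funext t
  rw [← mul_assoc, ← exp_I_mul_int_mul]
  ring

theorem torusOp_cos_mul {f : ℝ → ℂ} (hf : SmoothPeriodic f) (t : ℝ) :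
    torusOp (fun t => (Real.cos t : ℂ) * f t) t = (Real.cos t : ℂ) * torusOp f t +
      2 * Complex.I * (f t - (Real.cos t : ℂ) * ((Real.cos t : ℂ) * f t)) := by
  have h1 := (smoothPeriodic_cos_mul hf).hasDerivAt_sin_mul t
  have h2 : HasDerivAt (fun t : ℝ => (Real.cos t : ℂ) * f t)
      ((-Real.sin t : ℝ) * f t + (Real.cos t : ℂ) * deriv f t) t :=
    (Real.hasDerivAt_cos t).ofReal_comp.mul (hf.1.differentiable (by norm_num) t).hasDerivAt
  have h3 := hf.hasDerivAt_sin_mul t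
  have h4 : (Real.sin t : ℂ) ^ 2 + (Real.cos t : ℂ) ^ 2 = 1 := by
    exact_mod_cast Real.sin_sq_add_cos_sq t
  rw [torusOp, h1.deriv, h2.deriv, torusOp, h3.deriv]
  rw [Complex.ofReal_neg]
  linear_combination (2 * Complex.I * f t) * h4

theorem cosOp_mem_A0CoreGraph {p : EllTwo × EllTwo} (hp : p ∈ A0CoreGraph) :
    (cosOp p.1, cosOp p.2 + (2 * Complex.I) • (p.1 - cosOp (cosOp p.1))) ∈ A0CoreGraph := by
  obtain ⟨f, hf, h1, h2⟩ := hp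
  have hc := smoothPeriodic_cos_mul hf
  have hcc := smoothPeriodic_cos_mul hc
  have e1 : ∀ n, cosOp p.1 n = invFourier (fun t => (Real.cos t : ℂ) * f t) n := fun n => by
    rw [invFourier_cos_mul hf.1.continuous, cosOp_apply, h1, h1]
  refine ⟨_, hc, e1, fun n => ?_⟩
  have ht : torusOp (fun t => (Real.cos t : ℂ) * f t) =
      (fun t => (Real.cos t : ℂ) * torusOp f t) + (2 * Complex.I) • (f +
        (-1 : ℂ) • fun t => (Real.cos t : ℂ) * ((Real.cos t : ℂ) * f t)) := by
    funext t
    rw [torusOp_cos_mul hf]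
    simp only [Pi.add_apply, Pi.smul_apply, smul_eq_mul]
    ring
  have k1 : Continuous fun t => (Real.cos t : ℂ) * torusOp f t :=
    (Complex.continuous_ofReal.comp Real.continuous_cos).mul hf.continuous_torusOp
  have k2 := hf.1.continuous
  have k3 := hcc.1.continuous
  have k4 : Continuous (f +
        (-1 : ℂ) • fun t => (Real.cos t : ℂ) * ((Real.cos t : ℂ) * f t)) :=
    k2.add (k3.const_smul _)
  rw [ht, invFourier_add k1 (k4.const_smul _), invFourier_smul,
    invFourier_add k2 (k3.const_smul _), invFourier_smul, invFourier_cos_mul hf.continuous_torusOp,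
    invFourier_cos_mul hc.1.continuous, ← e1, ← e1, ← h1, ← h2, ← h2]
  change cosOp p.2 n + (2 * Complex.I) * (p.1 n - cosOp (cosOp p.1) n) = _
  rw [cosOp_apply, cosOp_apply (cosOp p.1)]
  ring

/-- The commutator `[A₀, C] = 2i (1 - C²)`, together with the invariance of the domain. -/
theorem cosOp_mem_A0_graph {x y : EllTwo} (h : (x, y) ∈ A0.graph) :
    (cosOp x, cosOp y + (2 * Complex.I) • (x - cosOp (cosOp x))) ∈ A0.graph := by
  rw [A0_graph] at h ⊢
  have hcont : Continuous fun p : EllTwo × EllTwo =>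
      (cosOp p.1, cosOp p.2 + (2 * Complex.I) • (p.1 - cosOp (cosOp p.1))) := by fun_prop
  have h' : (x, y) ∈ closure (A0CoreGraph : Set (EllTwo × EllTwo)) := h
  have := map_mem_closure (t := (A0CoreGraph : Set (EllTwo × EllTwo))) hcont h'
    fun p hp => cosOp_mem_A0CoreGraph hp
  exact this

/-! ### Density of the domain -/

/-- The function on the circle whose inverse Fourier transform is the basis vector at `m`. -/
noncomputable def expFun (m : ℤ) (t : ℝ) : ℂ :=
  ((√(2 * Real.pi))⁻¹ : ℝ) * Complex.exp (-(Complex.I * m * t))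

theorem smoothPeriodic_expFun (m : ℤ) : SmoothPeriodic (expFun m) := by
  refine ⟨?_, fun t => ?_⟩
  · have : ContDiff ℝ ∞ fun t : ℝ => (t : ℂ) := Complex.ofRealCLM.contDiff
    unfold expFun
    fun_prop
  · unfold expFun
    congr 1
    rw [Complex.exp_eq_exp_iff_exists_int]
    exact ⟨-m, by push_cast; ring⟩

theorem invFourier_expFun (m n : ℤ) : invFourier (expFun m) n = if n = m then 1 else 0 := by
  unfold invFourier expFun
  have h : ∀ t : ℝ, Complex.exp (Complex.I * n * t) * ((((√(2 * Real.pi))⁻¹ : ℝ) : ℂ) *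
      Complex.exp (-(Complex.I * m * t))) = (((√(2 * Real.pi))⁻¹ : ℝ) : ℂ) *
      Complex.exp ((Complex.I * (n - m : ℤ)) * t) := fun t => by
    rw [mul_left_comm, ← Complex.exp_add]
    congr 2
    push_cast
    ring
  simp only [h]
  rw [intervalIntegral.integral_const_mul]
  split_ifs with hnm
  · subst hnm
    have hs : (√(2 * Real.pi)) ≠ 0 := by positivity
    have hs2 : (√(2 * Real.pi)) * (√(2 * Real.pi)) = 2 * Real.pi :=
      Real.mul_self_sqrt (by positivity)
    simp only [sub_self, Int.cast_zero, mul_zero, zero_mul, Complex.exp_zero,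
      intervalIntegral.integral_const, sub_neg_eq_add, Complex.real_smul, mul_one]
    norm_cast
    field_simp
    linarith
  · have hk : (Complex.I * (n - m : ℤ)) ≠ 0 :=
      mul_ne_zero Complex.I_ne_zero (by exact_mod_cast sub_ne_zero.2 hnm)
    have : Complex.exp (Complex.I * (n - m : ℤ) * (Real.pi : ℝ)) =
        Complex.exp (Complex.I * (n - m : ℤ) * (-Real.pi : ℝ)) :=
      Complex.exp_eq_exp_iff_exists_int.2 ⟨n - m, by push_cast; ring⟩
    rw [integral_exp_mul_complex hk, this]
    simp

theorem torusOp_expFun (m : ℤ) : torusOp (expFun m) = (Complex.I / 2) •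
    ((2 * m - 1 : ℂ) • expFun (m - 1) + (-(2 * m + 1) : ℂ) • expFun (m + 1)) := by
  funext t
  have hE : HasDerivAt (expFun m) (-(Complex.I * m) * expFun m t) t := by
    have h1 : HasDerivAt (fun t : ℝ => -(Complex.I * m * (t : ℂ))) (-(Complex.I * m * 1)) t :=
      ((Complex.ofRealCLM.hasDerivAt (x := t)).const_mul (Complex.I * m)).neg
    refine (h1.cexp.const_mul (((√(2 * Real.pi))⁻¹ : ℝ) : ℂ)).congr_deriv ?_
    unfold expFun
    ring
  have e1 : expFun (m - 1) t = expFun m t * (Real.cos t + Real.sin t * Complex.I) := by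
    rw [Complex.ofReal_cos, Complex.ofReal_sin, ← Complex.exp_mul_I, expFun, expFun,
      mul_assoc (((√(2 * Real.pi))⁻¹ : ℝ) : ℂ),
      ← Complex.exp_add]
    congr 2; push_cast; ring
  have e2 : expFun (m + 1) t = expFun m t * (Real.cos t - Real.sin t * Complex.I) := by
    have : (Real.cos t - Real.sin t * Complex.I : ℂ) = Complex.exp ((-t : ℂ) * Complex.I) := by
      rw [Complex.exp_mul_I, Complex.cos_neg, Complex.sin_neg, Complex.ofReal_cos,
        Complex.ofReal_sin]
      ring
    rw [this, expFun, expFun,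
      mul_assoc (((√(2 * Real.pi))⁻¹ : ℝ) : ℂ), ← Complex.exp_add]
    congr 2; push_cast; ring
  rw [torusOp, ((smoothPeriodic_expFun m).hasDerivAt_sin_mul t).deriv, hE.deriv]
  simp only [Pi.add_apply, Pi.smul_apply, smul_eq_mul, e1, e2]
  ring

theorem exists_single_mem_A0_graph (m : ℤ) :
    ∃ y : EllTwo, ((lp.single 2 m (1 : ℂ) : EllTwo), y) ∈ A0.graph := by
  have hs : ∀ m n : ℤ, (lp.single 2 m (1 : ℂ) : EllTwo) n = invFourier (expFun m) n :=
    fun m n => by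
      rw [invFourier_expFun, lp.coeFn_single, Pi.single_apply]
  refine ⟨(Complex.I / 2) • ((2 * m - 1 : ℂ) • (lp.single 2 (m - 1) (1 : ℂ) : EllTwo) +
    (-(2 * m + 1) : ℂ) • (lp.single 2 (m + 1) (1 : ℂ) : EllTwo)), ?_⟩
  rw [A0_graph]
  refine Submodule.le_topologicalClosure _ ⟨expFun m, smoothPeriodic_expFun m, hs m, fun n => ?_⟩
  have hc := fun m => (smoothPeriodic_expFun m).1.continuous
  rw [torusOp_expFun, invFourier_smul,
    invFourier_add ((hc _).const_smul _) ((hc _).const_smul _), invFourier_smul, invFourier_smul,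
    ← hs, ← hs]
  rfl

theorem ext_of_eqOn_domain {S T : EllTwo →L[ℂ] EllTwo}
    (h : ∀ x y, (x, y) ∈ A0.graph → S x = T x) : S = T := by
  ext1 x
  have hsum := lp.hasSum_single (E := fun _ : ℤ => ℂ) (p := 2) (by norm_num) x
  refine (hsum.mapL S).unique ?_
  convert hsum.mapL T using 2 with m
  have : (lp.single 2 m (x m : ℂ) : EllTwo) = (x m : ℂ) • (lp.single 2 m (1 : ℂ) : EllTwo) := by
    rw [← lp.single_smul, smul_eq_mul, mul_one]
  obtain ⟨y, hy⟩ := exists_single_mem_A0_graph m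
  rw [this, map_smul, map_smul, h _ y hy]

/-! ### Conjugation of the free Hamiltonian by the unitary group -/

section RealScaling

variable {H : Type*} [NormedAddCommGroup H] [InnerProductSpace ℂ H] [CompleteSpace H]
  {A : H →ₗ.[ℂ] H} {U : ℝ → H →L[ℂ] H}

theorem IsUnitaryGroupOf.hasDerivAt_apply_neg (hU : IsUnitaryGroupOf A U) {x y : H}
    (h : (x, y) ∈ A.graph) (s : ℝ) :
    HasDerivAt (fun t : ℝ => U (-t) x) (-(Complex.I • U (-s) y)) s :=
  (hU.hasDerivAt h (-s)).scomp s (hasDerivAt_neg s) |>.congr_deriv (by simp)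

/-- The generator is symmetric: `i A` is skew with respect to the real inner product. -/
theorem IsUnitaryGroupOf.re_inner_I_smul (hU : IsUnitaryGroupOf A U) {x y : H}
    (h : (x, y) ∈ A.graph) : (inner ℂ x (Complex.I • y)).re = 0 := by
  have h0 := (hU.generator x y).1 h
  have h1 := (h0.inner ℂ h0).unique (by
    simp only [hU.inner_apply]
    exact hasDerivAt_const (0 : ℝ) (inner ℂ x x : ℂ))
  have h2 := congrArg Complex.re h1
  rw [hU.map_zero, one_apply_eq_self, Complex.add_re, ← inner_conj_symm (Complex.I • y) x,
    Complex.conj_re, Complex.zero_re] at h2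
  linarith

end RealScaling

section ScalarGronwall

variable {H : Type*} [NormedAddCommGroup H] [InnerProductSpace ℂ H]

/-- Uniqueness, in both time directions, for `W' = S W + B W` with `S` skew and `B` bounded: the
hypothesis `hK` sees only the bounded part. -/
theorem eq_zero_of_abs_re_inner_deriv_le {W W' : ℝ → H} {K : ℝ}
    (hW : ∀ t, HasDerivAt W (W' t) t) (h0 : W 0 = 0)
    (hK : ∀ t, |(inner ℂ (W t) (W' t)).re| ≤ K * ‖W t‖ ^ 2) (t : ℝ) : W t = 0 := by
  have hN : ∀ t, HasDerivAt (fun t => ‖W t‖ ^ 2) (2 * (inner ℂ (W t) (W' t)).re) t := fun t => by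
    have h1 := ((hW t).inner ℂ (hW t))
    have h2 := (Complex.reCLM.hasFDerivAt (x := inner ℂ (W t) (W t))).comp_hasDerivAt t h1
    have e : (fun t => ‖W t‖ ^ 2) = Complex.reCLM ∘ fun t => inner ℂ (W t) (W t) := by
      funext t
      simp [← inner_self_eq_norm_sq (𝕜 := ℂ)]
    rw [e]
    refine h2.congr_deriv ?_
    rw [Complex.reCLM_apply, Complex.add_re, ← inner_conj_symm (W' t) (W t), Complex.conj_re]
    ring
  have hb : ∀ t, ‖2 * (inner ℂ (W t) (W' t)).re‖ ≤ (2 * K) * ‖‖W t‖ ^ 2‖ := fun t => by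
    have := hK t
    rw [norm_mul, Real.norm_eq_abs, Real.norm_eq_abs, Real.norm_eq_abs, abs_two, abs_sq]
    linarith
  have key : ‖W t‖ ^ 2 = 0 := by
    rcases le_total 0 t with ht | ht
    · exact eq_zero_of_abs_deriv_le_mul_abs_self_of_eq_zero_right (a := 0) (b := t)
        (fun s _ => (hN s).continuousAt.continuousWithinAt)
        (fun s _ => (hN s).hasDerivWithinAt) (by simp [h0]) (fun s _ => hb s) t ⟨ht, le_rfl⟩
    · have hN' : ∀ s, HasDerivAt (fun s => ‖W (-s)‖ ^ 2)
          (-(2 * (inner ℂ (W (-s)) (W' (-s))).re)) s := fun s =>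
        ((hN (-s)).scomp s (hasDerivAt_neg s)).congr_deriv (by simp)
      have := eq_zero_of_abs_deriv_le_mul_abs_self_of_eq_zero_right (a := 0) (b := -t)
        (fun s _ => (hN' s).continuousAt.continuousWithinAt)
        (fun s _ => (hN' s).hasDerivWithinAt) (by simp [h0])
        (fun s _ => by rw [norm_neg]; exact hb (-s)) (-t) ⟨by linarith, le_rfl⟩
      simpa using this
  simpa using key

end ScalarGronwall

variable {U : ℝ → EllTwo →L[ℂ] EllTwo}

/-- The operators `C(θ) = e^{iθA₀} C e^{-iθA₀}` solve the Riccati equation `C' = -2 (1 - C²)`,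
whose solution is the Möbius transform `(C - tanh 2θ) / (1 - C tanh 2θ)` of `C`. This is that
formula with the denominator cleared, proved from the linear differential equation which the
difference of the two sides satisfies. -/
theorem cosOp_mul_group (hU : IsUnitaryGroupOf A0 U) (θ : ℝ) :
    cosOp * U (-θ) * ((Real.cosh (2 * θ) : ℂ) • 1 - (Real.sinh (2 * θ) : ℂ) • cosOp) =
      U (-θ) * ((Real.cosh (2 * θ) : ℂ) • cosOp - (Real.sinh (2 * θ) : ℂ) • 1) := by
  refine ext_of_eqOn_domain fun x y hxy => ?_
  rw [← sub_eq_zero]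
  set x₁ := cosOp x with hx₁
  set y₁ := cosOp y + (2 * Complex.I) • (x - cosOp (cosOp x)) with hy₁
  have hxy₁ : (x₁, y₁) ∈ A0.graph := cosOp_mem_A0_graph hxy
  let c : ℝ → ℂ := fun t => (Real.cosh (2 * t) : ℂ)
  let s : ℝ → ℂ := fun t => (Real.sinh (2 * t) : ℂ)
  have hc : ∀ t, HasDerivAt c (2 * s t) t := fun t => by
    have h1 : HasDerivAt (fun t : ℝ => 2 * t) (2 * 1) t := (hasDerivAt_id' t).const_mul 2
    have := ((Real.hasDerivAt_cosh (2 * t)).comp t h1).ofReal_comp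
    refine this.congr_deriv ?_
    simp only [s]; push_cast; ring
  have hs : ∀ t, HasDerivAt s (2 * c t) t := fun t => by
    have h1 : HasDerivAt (fun t : ℝ => 2 * t) (2 * 1) t := (hasDerivAt_id' t).const_mul 2
    have := ((Real.hasDerivAt_sinh (2 * t)).comp t h1).ofReal_comp
    refine this.congr_deriv ?_
    simp only [c]; push_cast; ring
  let w : ℝ → EllTwo := fun t => c t • U (-t) x - s t • U (-t) x₁
  let v : ℝ → EllTwo := fun t => c t • U (-t) x₁ - s t • U (-t) x
  let Aw : ℝ → EllTwo := fun t => c t • U (-t) y - s t • U (-t) y₁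
  let Av : ℝ → EllTwo := fun t => c t • U (-t) y₁ - s t • U (-t) y
  have hw : ∀ t, HasDerivAt w (-(Complex.I • Aw t) - (2 : ℂ) • v t) t := fun t => by
    refine (((hc t).smul (hU.hasDerivAt_apply_neg hxy t)).sub
      ((hs t).smul (hU.hasDerivAt_apply_neg hxy₁ t))).congr_deriv ?_
    simp only [v, Aw]
    module
  have hv : ∀ t, HasDerivAt v (-(Complex.I • Av t) - (2 : ℂ) • w t) t := fun t => by
    refine (((hc t).smul (hU.hasDerivAt_apply_neg hxy₁ t)).sub
      ((hs t).smul (hU.hasDerivAt_apply_neg hxy t))).congr_deriv ?_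
    simp only [w, Av]
    module
  let W : ℝ → EllTwo := fun t => cosOp (w t) - v t
  let AW : ℝ → EllTwo := fun t =>
    (cosOp (Aw t) + (2 * Complex.I) • (w t - cosOp (cosOp (w t)))) - Av t
  have hgw : ∀ t, (w t, Aw t) ∈ A0.graph := fun t =>
    sub_mem (A0.graph.smul_mem (c t) (hU.apply_mem_graph hxy (-t)))
      (A0.graph.smul_mem (s t) (hU.apply_mem_graph hxy₁ (-t)))
  have hgv : ∀ t, (v t, Av t) ∈ A0.graph := fun t =>
    sub_mem (A0.graph.smul_mem (c t) (hU.apply_mem_graph hxy₁ (-t)))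
      (A0.graph.smul_mem (s t) (hU.apply_mem_graph hxy (-t)))
  have hgW : ∀ t, (W t, AW t) ∈ A0.graph := fun t =>
    sub_mem (cosOp_mem_A0_graph (hgw t)) (hgv t)
  have hW : ∀ t, HasDerivAt W (-(Complex.I • AW t) + (2 : ℂ) • cosOp (W t)) t := fun t => by
    have h1 := ((cosOp.restrictScalars ℝ).hasFDerivAt).comp_hasDerivAt t (hw t)
    refine (h1.sub (hv t)).congr_deriv ?_
    simp only [W, AW, ContinuousLinearMap.coe_restrictScalars', map_sub, map_neg, map_smul,
      smul_sub, smul_add, smul_smul]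
    have hI : Complex.I * (2 * Complex.I) = -2 := by linear_combination 2 * Complex.I_sq
    rw [hI]
    module
  have hW0 : W 0 = 0 := by
    simp [W, w, v, c, s, hU.map_zero, hx₁]
  have hfin := eq_zero_of_abs_re_inner_deriv_le (K := 2) hW hW0 (fun t => by
    have h1 := hU.re_inner_I_smul (hgW t)
    rw [inner_add_right, inner_neg_right, Complex.add_re, Complex.neg_re, h1, neg_zero, zero_add]
    calc |(inner ℂ (W t) ((2 : ℂ) • cosOp (W t))).re|
        ≤ ‖inner ℂ (W t) ((2 : ℂ) • cosOp (W t))‖ := Complex.abs_re_le_norm _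
      _ ≤ ‖W t‖ * ‖(2 : ℂ) • cosOp (W t)‖ := norm_inner_le_norm _ _
      _ ≤ ‖W t‖ * (2 * (1 * ‖W t‖)) := by
        rw [norm_smul, Complex.norm_ofNat]
        gcongr
        exact cosOp.le_of_opNorm_le norm_cosOp_le _
      _ = 2 * ‖W t‖ ^ 2 := by ring) θ
  simp only [W, w, v, c, s] at hfin
  simpa [mul_apply_eq_comp, ← hx₁] using hfin

/-! ### The complex scaled free Hamiltonian -/

/-- The denominator `cosh 2θ - sinh 2θ C` of the Möbius transform. -/
noncomputable def scaledDenom (θ : ℂ) : EllTwo →L[ℂ] EllTwo :=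
  Complex.cosh (2 * θ) • 1 - Complex.sinh (2 * θ) • cosOp

/-- The continuation `2 - 2 (cosh 2θ C - sinh 2θ) / (cosh 2θ - sinh 2θ C)` of
`e^{iθA₀} H₀ e^{-iθA₀}` to complex `θ`. -/
noncomputable def scaledH0 (θ : ℂ) : EllTwo →L[ℂ] EllTwo :=
  (2 : ℂ) • 1 - (2 : ℂ) • ((Complex.cosh (2 * θ) • cosOp - Complex.sinh (2 * θ) • 1) *
    Ring.inverse (scaledDenom θ))

theorem normSq_cosh_sub_normSq_sinh (θ : ℂ) :
    Complex.normSq (Complex.cosh (2 * θ)) - Complex.normSq (Complex.sinh (2 * θ)) =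
      Real.cos (4 * θ.im) := by
  have e : 2 * θ = ((2 * θ.re : ℝ) : ℂ) + ((2 * θ.im : ℝ) : ℂ) * Complex.I := by
    apply Complex.ext <;> simp
  have h1 := Real.cosh_sq (2 * θ.re)
  have h2 := Real.sin_sq_add_cos_sq (2 * θ.im)
  rw [show 4 * θ.im = 2 * (2 * θ.im) by ring, Real.cos_two_mul, e, Complex.cosh_add,
    Complex.sinh_add, Complex.cosh_mul_I, Complex.sinh_mul_I, ← Complex.ofReal_cosh,
    ← Complex.ofReal_sinh, ← Complex.ofReal_cos, ← Complex.ofReal_sin]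
  simp only [Complex.normSq_apply, Complex.add_re, Complex.add_im, Complex.mul_re, Complex.mul_im,
    Complex.ofReal_re, Complex.ofReal_im, Complex.I_re, Complex.I_im]
  linear_combination (Real.cos (2 * θ.im) ^ 2 - Real.sin (2 * θ.im) ^ 2) * h1 - h2

theorem im_sinh_mul_conj_cosh (θ : ℂ) :
    (Complex.sinh (2 * θ) * (starRingEnd ℂ) (Complex.cosh (2 * θ))).im =
      Real.sin (4 * θ.im) / 2 := by
  have e : 2 * θ = ((2 * θ.re : ℝ) : ℂ) + ((2 * θ.im : ℝ) : ℂ) * Complex.I := by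
    apply Complex.ext <;> simp
  have h1 := Real.cosh_sq (2 * θ.re)
  rw [show 4 * θ.im = 2 * (2 * θ.im) by ring, Real.sin_two_mul, e, Complex.cosh_add,
    Complex.sinh_add, Complex.cosh_mul_I, Complex.sinh_mul_I, ← Complex.ofReal_cosh,
    ← Complex.ofReal_sinh, ← Complex.ofReal_cos, ← Complex.ofReal_sin]
  simp only [Complex.add_re, Complex.add_im, Complex.mul_re, Complex.mul_im, Complex.conj_re,
    Complex.conj_im, Complex.ofReal_re, Complex.ofReal_im, Complex.I_re, Complex.I_im]
  linear_combination (Real.cos (2 * θ.im) * Real.sin (2 * θ.im)) * h1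

theorem cos_four_mul_pos {b : ℝ} (hb : |b| < Real.pi / 8) : 0 < Real.cos (4 * b) := by
  have := abs_lt.1 hb
  exact Real.cos_pos_of_mem_Ioo ⟨by linarith, by linarith⟩

theorem isUnit_scaledDenom {θ : ℂ} (hθ : |θ.im| < Real.pi / 8) : IsUnit (scaledDenom θ) := by
  have h1 : ‖Complex.sinh (2 * θ)‖ < ‖Complex.cosh (2 * θ)‖ := by
    have h2 := normSq_cosh_sub_normSq_sinh θ
    rw [Complex.normSq_eq_norm_sq, Complex.normSq_eq_norm_sq] at h2
    exact lt_of_pow_lt_pow_left₀ 2 (norm_nonneg _) (by linarith [cos_four_mul_pos hθ])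
  have hc : Complex.cosh (2 * θ) ≠ 0 := norm_pos_iff.1 ((norm_nonneg _).trans_lt h1)
  have e : scaledDenom θ = Complex.cosh (2 * θ) •
      (1 - (Complex.sinh (2 * θ) / Complex.cosh (2 * θ)) • cosOp) := by
    rw [scaledDenom, smul_sub, smul_smul, mul_div_cancel₀ _ hc]
  rw [e]
  refine (isUnit_one_sub_of_norm_lt_one ?_).smul (Units.mk0 _ hc)
  rw [norm_smul, norm_div]
  calc _ ≤ ‖Complex.sinh (2 * θ)‖ / ‖Complex.cosh (2 * θ)‖ * 1 := by gcongr; exact norm_cosOp_le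
    _ < 1 := by rw [mul_one, div_lt_one ((norm_nonneg _).trans_lt h1)]; exact h1

theorem differentiableAt_scaledH0 {θ : ℂ} (hθ : |θ.im| < Real.pi / 8) :
    DifferentiableAt ℂ scaledH0 θ := by
  have h0 : DifferentiableAt ℂ scaledDenom θ := by unfold scaledDenom; fun_prop
  have h1 : DifferentiableAt ℂ (fun θ => Ring.inverse (scaledDenom θ)) θ :=
    (differentiableAt_inverse (isUnit_scaledDenom hθ)).comp θ h0
  unfold scaledH0
  refine (differentiableAt_const _).sub
    (DifferentiableAt.fun_const_smul (DifferentiableAt.fun_mul ?_ h1) _)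
  fun_prop

theorem scaledH0_ofReal (hU : IsUnitaryGroupOf A0 U) (θ : ℝ) :
    scaledH0 θ = U θ * H0 * U (-θ) := by
  have hu : IsUnit (scaledDenom (θ : ℂ)) := isUnit_scaledDenom (by simp; positivity)
  have h1 := congrArg (fun T => U θ * T) (cosOp_mul_group hU θ)
  have h2 : U θ * cosOp * U (-θ) * scaledDenom θ =
      Complex.cosh (2 * θ) • cosOp - Complex.sinh (2 * θ) • 1 := by
    simp only [← mul_assoc, hU.mul_neg, one_mul] at h1
    rw [scaledDenom]
    exact_mod_cast h1
  rw [scaledH0, ← h2, mul_assoc _ (scaledDenom _), Ring.mul_inverse_cancel _ hu, mul_one,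
    H0_eq_cosOp, mul_sub, sub_mul]
  simp [hU.mul_neg]

theorem isUnit_smul_one_add_smul {T : EllTwo →L[ℂ] EllTwo} (hT : IsSelfAdjoint T) {α β : ℂ}
    (h : (α * (starRingEnd ℂ) β).im ≠ 0) : IsUnit (α • 1 + β • T) := by
  have hβ : β ≠ 0 := by rintro rfl; simp at h
  have him : (-α / β).im ≠ 0 := by
    have e : -α / β = -(α * (starRingEnd ℂ) β) / (Complex.normSq β : ℂ) := by
      rw [← Complex.mul_conj]
      have : (starRingEnd ℂ) β ≠ 0 := by simpa using hβ
      field_simp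
    rw [e, Complex.div_ofReal_im, Complex.neg_im]
    exact div_ne_zero (neg_ne_zero.2 h) (by simpa using hβ)
  have hns : -α / β ∉ spectrum ℂ T := fun hm => him (hT.im_eq_zero_of_mem_spectrum hm)
  have hu := spectrum.notMem_iff.1 hns
  have e : α • (1 : EllTwo →L[ℂ] EllTwo) + β • T =
      (-β) • (algebraMap ℂ (EllTwo →L[ℂ] EllTwo) (-α / β) - T) := by
    rw [Algebra.algebraMap_eq_smul_one, smul_sub, smul_smul]
    rw [show -β * (-α / β) = α by field_simp, neg_smul, sub_neg_eq_add]
  rw [e]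
  exact hu.smul (Units.mk0 (-β) (neg_ne_zero.2 hβ))

/-- The quantity `1 - |1 - z/2|²`, positive in the disc with diameter `(0, 4)`. -/
noncomputable def discGap (z : ℂ) : ℝ := 1 - Complex.normSq (1 - z / 2)

/-- For `Im θ = b` the spectrum of `scaledH0 θ` lies on the curve
`cos 4b Im z = sin 4b (1 - |1 - z/2|²)`, which is the real line for `b = 0` and otherwise a circle
through `0` and `4`. -/
theorem isUnit_sub_scaledH0 {θ z : ℂ} (hθ : |θ.im| < Real.pi / 8)
    (h : Real.cos (4 * θ.im) * z.im - Real.sin (4 * θ.im) * discGap z ≠ 0) :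
    IsUnit (algebraMap ℂ (EllTwo →L[ℂ] EllTwo) z - scaledH0 θ) := by
  have hu := isUnit_scaledDenom hθ
  set c := Complex.cosh (2 * θ) with hc
  set s := Complex.sinh (2 * θ) with hs
  have e : algebraMap ℂ (EllTwo →L[ℂ] EllTwo) z - scaledH0 θ =
      (((z - 2) * c - 2 * s) • 1 + (2 * c - (z - 2) * s) • cosOp) *
        Ring.inverse (scaledDenom θ) := by
    have h1 : (1 : EllTwo →L[ℂ] EllTwo) = scaledDenom θ * Ring.inverse (scaledDenom θ) :=
      (Ring.mul_inverse_cancel _ hu).symm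
    have h2 : algebraMap ℂ (EllTwo →L[ℂ] EllTwo) z - scaledH0 θ =
        (z - 2) • (scaledDenom θ * Ring.inverse (scaledDenom θ)) + (2 : ℂ) • ((c • cosOp - s • 1) *
          Ring.inverse (scaledDenom θ)) := by
      rw [← h1, scaledH0, Algebra.algebraMap_eq_smul_one, sub_smul]
      abel
    rw [h2, ← smul_mul_assoc, ← smul_mul_assoc, ← add_mul]
    congr 1
    rw [scaledDenom, ← hc, ← hs]
    module
  rw [e]
  refine (isUnit_smul_one_add_smul isSelfAdjoint_cosOp ?_).mul (hu.ringInverse)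
  have h1 := normSq_cosh_sub_normSq_sinh θ
  have h2 := im_sinh_mul_conj_cosh θ
  rw [← hc, ← hs] at h1 h2
  have h3 : (((z - 2) * c - 2 * s) * (starRingEnd ℂ) (2 * c - (z - 2) * s)).im =
      2 * (Real.cos (4 * θ.im) * z.im - Real.sin (4 * θ.im) * discGap z) := by
    have h4 : Real.sin (4 * θ.im) = 2 * (s * (starRingEnd ℂ) c).im := by linarith
    rw [← h1, h4, discGap]
    simp [Complex.normSq_apply]
    ring
  rw [h3]
  exact mul_ne_zero two_ne_zero h

/-! ### Complex scaling of the perturbed Hamiltonian -/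

/-- `F` continues `θ ↦ e^{iθA₀} V e^{-iθA₀}`, for a compact operator `V`, to the disc of radius
`ρ`. The bound on `ρ` keeps `scaledH0` holomorphic on that disc. -/
structure IsScalingFamily (U : ℝ → EllTwo →L[ℂ] EllTwo) (V : EllTwo →L[ℂ] EllTwo)
    (F : ℂ → EllTwo →L[ℂ] EllTwo) (ρ : ℝ) : Prop where
  group : IsUnitaryGroupOf A0 U
  compact : IsCompactOperator V
  radius_pos : 0 < ρ
  radius_le : ρ ≤ Real.pi / 8
  differentiableOn : DifferentiableOn ℂ F (Metric.ball 0 ρ)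
  ofReal : ∀ θ : ℝ, |θ| < ρ → F θ = U θ * V * U (-θ)

/-- The complex scaled perturbed Hamiltonian. -/
noncomputable def scaledH (F : ℂ → EllTwo →L[ℂ] EllTwo) (θ : ℂ) : EllTwo →L[ℂ] EllTwo :=
  scaledH0 θ + F θ

/-- For `Im θ = -ε t` the operator `z - scaledH0 θ` is invertible where this is positive. For small
`t > 0` the region of these `z` is a disc which contains `(0, 4)`, and which exhausts the half plane
`ε Im z > 0` as `t → 0`. -/
noncomputable def sideGap (ε t : ℝ) (z : ℂ) : ℝ :=
  Real.cos (4 * t) * (ε * z.im) + Real.sin (4 * t) * discGap z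

theorem continuous_discGap : Continuous discGap := by
  unfold discGap
  exact continuous_const.sub (Complex.continuous_normSq.comp (by fun_prop))

theorem sideGap_pos {ε t : ℝ} {z : ℂ} (ht : 0 < t) (htπ : t < Real.pi / 8)
    (hz : 0 < discGap z) (him : 0 ≤ ε * z.im) : 0 < sideGap ε t z := by
  have h1 := cos_four_mul_pos (abs_lt.2 ⟨by linarith, htπ⟩)
  have h2 : 0 < Real.sin (4 * t) := Real.sin_pos_of_pos_of_lt_pi (by linarith) (by linarith)
  unfold sideGap
  positivity

theorem convex_setOf_sideGap_pos (ε : ℝ) {t : ℝ} (ht : 0 ≤ t) (htπ : t < Real.pi / 8) :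
    Convex ℝ {z : ℂ | 0 < sideGap ε t z} := by
  have hs : 0 ≤ Real.sin (4 * t) :=
    Real.sin_nonneg_of_nonneg_of_le_pi (by linarith) (by linarith [Real.pi_pos])
  intro x hx y hy a b ha hb hab
  have hx' : 0 < sideGap ε t x := hx
  have hy' : 0 < sideGap ε t y := hy
  change 0 < sideGap ε t (a • x + b • y)
  have hconc : a * discGap x + b * discGap y ≤ discGap (a • x + b • y) := by
    obtain rfl : b = 1 - a := by linarith
    simp only [discGap, Complex.normSq_apply, Complex.sub_re, Complex.sub_im, Complex.add_re,
      Complex.add_im, Complex.one_re, Complex.one_im, Complex.div_ofNat_re, Complex.div_ofNat_im,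
      Complex.real_smul, Complex.re_ofReal_mul, Complex.im_ofReal_mul]
    nlinarith [mul_nonneg (mul_nonneg ha hb) (sq_nonneg (x.re - y.re)),
      mul_nonneg (mul_nonneg ha hb) (sq_nonneg (x.im - y.im))]
  have hpos : 0 < a * sideGap ε t x + b * sideGap ε t y := by
    rcases ha.eq_or_lt with h | h
    · have : b = 1 := by linarith
      subst h this
      simpa using hy'
    · exact add_pos_of_pos_of_nonneg (mul_pos h hx') (mul_nonneg hb hy'.le)
  have hle := mul_le_mul_of_nonneg_left hconc hs
  have him : (a • x + b • y).im = a * x.im + b * y.im := by simp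
  unfold sideGap at hpos ⊢
  rw [him]
  nlinarith

/-- Positivity of `sideGap` persists when `t` increases. -/
theorem sideGap_pos_of_le {ε s t : ℝ} {z : ℂ} (hs : -(Real.pi / 8) < s) (hst : s ≤ t)
    (ht : t < Real.pi / 8) (hz : 0 < discGap z) (him : 0 ≤ ε * z.im) (h : 0 < sideGap ε s z) :
    0 < sideGap ε t z := by
  rcases lt_or_ge 0 t with h0 | h0
  · exact sideGap_pos h0 ht hz him
  · have h1 : Real.sin (4 * s) ≤ Real.sin (4 * t) :=
      Real.sin_le_sin_of_le_of_le_pi_div_two (by linarith) (by linarith) (by linarith)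
    have h2 : Real.cos (4 * s) ≤ Real.cos (4 * t) := by
      rw [← Real.cos_neg (4 * s), ← Real.cos_neg (4 * t)]
      exact Real.cos_le_cos_of_nonneg_of_le_pi (by linarith) (by linarith) (by linarith)
    refine h.trans_le ?_
    unfold sideGap
    gcongr

/-- The scaling parameters for which `z` lies off the essential spectrum, on the side `ε`. -/
def scalingDomain (ρ ε : ℝ) (z : ℂ) : Set ℂ :=
  Metric.ball 0 ρ ∩ {θ | 0 < sideGap ε (-(ε * θ.im)) z}

theorem isOpen_scalingDomain (ρ ε : ℝ) (z : ℂ) : IsOpen (scalingDomain ρ ε z) := by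
  refine Metric.isOpen_ball.inter (isOpen_lt continuous_const ?_)
  unfold sideGap
  fun_prop

theorem abs_im_lt_of_mem_ball {θ : ℂ} {ρ : ℝ} (hθ : θ ∈ Metric.ball (0 : ℂ) ρ) : |θ.im| < ρ :=
  (Complex.abs_im_le_norm θ).trans_lt (mem_ball_zero_iff.1 hθ)

theorem convex_scalingDomain {ρ ε : ℝ} (hρ : ρ ≤ Real.pi / 8) (hε : |ε| = 1) {z : ℂ}
    (hz : 0 < discGap z) (him : 0 ≤ ε * z.im) : Convex ℝ (scalingDomain ρ ε z) := by
  let S : Set ℝ := {t | |t| < Real.pi / 8 ∧ 0 < sideGap ε t z}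
  have hS : Convex ℝ S := by
    refine Set.OrdConnected.convex ⟨fun s hs t ht u hu => ?_⟩
    have h1 := abs_lt.1 hs.1
    have h2 := abs_lt.1 ht.1
    exact ⟨abs_lt.2 ⟨h1.1.trans_le hu.1, hu.2.trans_lt h2.2⟩,
      sideGap_pos_of_le h1.1 hu.1 (hu.2.trans_lt h2.2) hz him hs.2⟩
  have e : scalingDomain ρ ε z =
      Metric.ball 0 ρ ∩ (-(ε • Complex.imLm) : ℂ →ₗ[ℝ] ℝ) ⁻¹' S := by
    ext θ
    refine and_congr_right fun hθ => ?_
    have h1 : |-(ε * θ.im)| < Real.pi / 8 := by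
      rw [abs_neg, abs_mul, hε, one_mul]
      exact (abs_im_lt_of_mem_ball hθ).trans_le hρ
    exact ⟨fun h => ⟨h1, h⟩, fun h => h.2⟩
  rw [e]
  exact (convex_ball 0 ρ).inter (hS.linear_preimage _)

theorem isUnit_sub_scaledH0_of_mem {ρ ε : ℝ} (hρ : ρ ≤ Real.pi / 8) (hε : ε * ε = 1) {z θ : ℂ}
    (hθ : θ ∈ Metric.ball (0 : ℂ) ρ) (h : 0 < sideGap ε (-(ε * θ.im)) z) :
    IsUnit (algebraMap ℂ (EllTwo →L[ℂ] EllTwo) z - scaledH0 θ) := by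
  refine isUnit_sub_scaledH0 ((abs_im_lt_of_mem_ball hθ).trans_le hρ) fun h0 => h.ne' ?_
  have hsq : (ε - 1) * (ε + 1) = 0 := by linarith
  unfold sideGap
  rcases mul_eq_zero.1 hsq with h1 | h1
  · obtain rfl : ε = 1 := by linarith
    rw [one_mul, mul_neg, Real.cos_neg, Real.sin_neg]
    linarith
  · obtain rfl : ε = -1 := by linarith
    rw [show 4 * -(-1 * θ.im) = 4 * θ.im by ring]
    linarith

namespace IsScalingFamily

variable {U : ℝ → EllTwo →L[ℂ] EllTwo} {V : EllTwo →L[ℂ] EllTwo}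
  {F : ℂ → EllTwo →L[ℂ] EllTwo} {ρ : ℝ}

theorem differentiableOn_scaledH (hF : IsScalingFamily U V F ρ) :
    DifferentiableOn ℂ (scaledH F) (Metric.ball 0 ρ) := fun θ hθ =>
  (differentiableAt_scaledH0 ((abs_im_lt_of_mem_ball hθ).trans_le
    hF.radius_le)).differentiableWithinAt.add (hF.differentiableOn θ hθ)

theorem scaledH_ofReal (hF : IsScalingFamily U V F ρ) {θ : ℝ} (hθ : |θ| < ρ) :
    scaledH F θ = U θ * (H0 + V) * U (-θ) := by
  rw [scaledH, scaledH0_ofReal hF.group, hF.ofReal θ hθ]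
  noncomm_ring

theorem scaledH_zero (hF : IsScalingFamily U V F ρ) : scaledH F 0 = H0 + V := by
  have := hF.scaledH_ofReal (θ := 0) (by simpa using hF.radius_pos)
  simpa [hF.group.map_zero] using this

theorem isCompactOperator (hF : IsScalingFamily U V F ρ) {θ : ℂ} (hθ : θ ∈ Metric.ball (0 : ℂ) ρ) :
    IsCompactOperator (F θ) := by
  have h : ∀ᶠ x : ℝ in 𝓝[>] 0, F x ∈ compactOperator (RingHom.id ℂ) EllTwo EllTwo := by
    filter_upwards [Ioo_mem_nhdsGT hF.radius_pos] with x hx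
    rw [hF.ofReal x (abs_lt.2 ⟨by linarith [hx.1, hx.2], hx.2⟩)]
    exact (hF.compact.clm_comp (U x)).comp_clm (U (-x))
  exact mem_of_eventually_ofReal_mem Metric.isOpen_ball (convex_ball _ _).isPreconnected
    hF.differentiableOn (x₀ := 0) (by simpa using hF.radius_pos)
    isClosed_setOfPred_isCompactOperator h hθ

theorem scaledH_add_ofReal (hF : IsScalingFamily U V F ρ) {θ : ℂ} {a : ℝ}
    (hθ : θ ∈ Metric.ball (0 : ℂ) ρ) (hθa : θ + a ∈ Metric.ball (0 : ℂ) ρ) :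
    scaledH F (θ + a) = U a * scaledH F θ * U (-a) := by
  let S : Set ℂ := Metric.ball 0 ρ ∩ (fun w => w + (a : ℂ)) ⁻¹' Metric.ball 0 ρ
  have hS : IsOpen S := Metric.isOpen_ball.inter (Metric.isOpen_ball.preimage (by fun_prop))
  have hconv : Convex ℝ S := (convex_ball _ _).inter
    ((convex_ball (0 : ℂ) ρ).translate_preimage_left (a : ℂ))
  have hre : ((θ.re : ℝ) : ℂ) ∈ S := by
    have h1 := (Complex.abs_re_le_norm θ).trans_lt (mem_ball_zero_iff.1 hθ)
    have h2 := (Complex.abs_re_le_norm (θ + a)).trans_lt (mem_ball_zero_iff.1 hθa)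
    refine ⟨mem_ball_zero_iff.2 (by simpa using h1), mem_ball_zero_iff.2 ?_⟩
    rw [Complex.add_re, Complex.ofReal_re] at h2
    beta_reduce
    rwa [← Complex.ofReal_add, Complex.norm_real, Real.norm_eq_abs]
  have hdl : DifferentiableOn ℂ (fun w => scaledH F (w + a)) S :=
    hF.differentiableOn_scaledH.comp (by fun_prop) fun w hw => hw.2
  have hdr : DifferentiableOn ℂ (fun w => U a * scaledH F w * U (-a)) S :=
    ((hF.differentiableOn_scaledH.mono inter_subset_left).const_mul _).mul_const _
  refine eqOn_of_eventuallyEq_ofReal hS hconv.isPreconnected hdl hdr hre ?_ ⟨hθ, hθa⟩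
  have hnear : ∀ᶠ x : ℝ in 𝓝[>] θ.re, (x : ℂ) ∈ S :=
    (Complex.continuous_ofReal.continuousAt.eventually (hS.mem_nhds hre)).filter_mono
      nhdsWithin_le_nhds
  filter_upwards [hnear] with x hx
  have h1 : |x| < ρ := by simpa using hx.1
  have h2 : |x + a| < ρ := by
    have := mem_ball_zero_iff.1 hx.2
    beta_reduce at this
    rwa [← Complex.ofReal_add, Complex.norm_real, Real.norm_eq_abs] at this
  rw [← Complex.ofReal_add, hF.scaledH_ofReal h1, hF.scaledH_ofReal h2, add_comm x a,
    hF.group.map_add, neg_add_rev, hF.group.map_add]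
  noncomm_ring

/-- Off the essential spectrum, invertibility of `z - H(θ)` does not depend on `θ`: the exceptional
`θ` would be isolated by the analytic Fredholm theorem, but they are invariant under real
translations. -/
theorem isUnit_sub_scaledH_of_mem (hF : IsScalingFamily U V F ρ) {ε : ℝ} (hε : ε * ε = 1) {z : ℂ}
    (hz : 0 < discGap z) (him : 0 ≤ ε * z.im) {θ₁ θ₂ : ℂ} (h₁ : θ₁ ∈ scalingDomain ρ ε z)
    (h₂ : θ₂ ∈ scalingDomain ρ ε z)
    (hu : IsUnit (algebraMap ℂ (EllTwo →L[ℂ] EllTwo) z - scaledH F θ₁)) :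
    IsUnit (algebraMap ℂ (EllTwo →L[ℂ] EllTwo) z - scaledH F θ₂) := by
  have hεa : |ε| = 1 := by
    rw [← sq_eq_sq₀ (abs_nonneg _) zero_le_one, sq_abs]; linarith
  have hev := eventually_isUnit_sub_of_isPreconnected (isOpen_scalingDomain ρ ε z)
    (convex_scalingDomain hF.radius_le hεa hz him).isPreconnected
    (A := fun θ => algebraMap ℂ (EllTwo →L[ℂ] EllTwo) z - scaledH0 θ) (K := F)
    (fun θ hθ => ((differentiableAt_scaledH0 ((abs_im_lt_of_mem_ball hθ.1).trans_le
      hF.radius_le)).const_sub _).differentiableWithinAt)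
    (fun θ hθ => isUnit_sub_scaledH0_of_mem hF.radius_le hε hθ.1 hθ.2)
    (hF.differentiableOn.mono inter_subset_left) (fun θ hθ => hF.isCompactOperator hθ.1) h₁
    (by rwa [sub_sub]) h₂
  have ht : Tendsto (fun a : ℝ => θ₂ + (a : ℂ)) (𝓝[>] 0) (𝓝[≠] θ₂) := by
    refine tendsto_nhdsWithin_iff.2 ⟨?_, eventually_mem_nhdsWithin.mono fun a ha => ?_⟩
    · have : Continuous fun a : ℝ => θ₂ + (a : ℂ) := by fun_prop
      have h := this.tendsto 0
      simp only [Complex.ofReal_zero, add_zero] at h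
      exact h.mono_left nhdsWithin_le_nhds
    · simpa using (ne_of_gt ha)
  have hball : ∀ᶠ y in 𝓝[≠] θ₂, y ∈ Metric.ball (0 : ℂ) ρ :=
    (Metric.isOpen_ball.mem_nhds h₂.1 : _ ∈ 𝓝 θ₂) |> mem_nhdsWithin_of_mem_nhds
  obtain ⟨a, hau, hab⟩ := ((ht.eventually hev).and (ht.eventually hball)).exists
  have e : algebraMap ℂ (EllTwo →L[ℂ] EllTwo) z - scaledH F θ₂ =
      U (-a) * (algebraMap ℂ (EllTwo →L[ℂ] EllTwo) z - scaledH0 (θ₂ + a) - F (θ₂ + a)) * U a := by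
    rw [sub_sub, ← scaledH, hF.scaledH_add_ofReal h₂.1 hab, mul_sub, sub_mul,
      (Algebra.commutes z (U (-a))).symm, mul_assoc _ (U (-a)) (U a), hF.group.neg_mul, mul_one]
    congr 1
    rw [mul_assoc, mul_assoc _ (U (-a)), hF.group.neg_mul, mul_one, ← mul_assoc,
      hF.group.neg_mul, one_mul]
  rw [e]
  exact ((hF.group.isUnit _).mul hau).mul (hF.group.isUnit _)

end IsScalingFamily

/-! ### The exceptional points and the boundary values of the resolvent -/

theorem discGap_ofReal_pos {x : ℝ} (hx : x ∈ Ioo (0 : ℝ) 4) : 0 < discGap x := by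
  have e : (1 - (x : ℂ) / 2) = ((1 - x / 2 : ℝ) : ℂ) := by push_cast; ring
  rw [discGap, e, Complex.normSq_ofReal]
  nlinarith [hx.1, hx.2]

theorem MemScalingClass.exists_isScalingFamily {V : EllTwo →L[ℂ] EllTwo}
    (hV : IsCompactOperator V) (hVA : MemScalingClass A0 V) :
    ∃ U F ρ, IsScalingFamily U V F ρ := by
  obtain ⟨R, hR, U, hU, F, hF, hFU⟩ := hVA
  refine ⟨U, F, min R (Real.pi / 8), hU, hV, lt_min hR (by positivity), min_le_right _ _,
    hF.mono (Metric.ball_subset_ball (min_le_left _ _)), fun θ hθ => hFU θ ?_⟩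
  exact hθ.trans_le (min_le_left _ _)

/-- The purely imaginary scaling parameter for which the essential spectrum is moved away from the
side `ε` of the real axis. -/
noncomputable def imagParam (ε t : ℝ) : ℂ := ((-(ε * t) : ℝ) : ℂ) * Complex.I

theorem imagParam_im (ε t : ℝ) : (imagParam ε t).im = -(ε * t) := by simp [imagParam]

theorem imagParam_mem_ball {ε t ρ : ℝ} (hε : |ε| = 1) (ht : 0 ≤ t) (htρ : t < ρ) :
    imagParam ε t ∈ Metric.ball (0 : ℂ) ρ := by
  rw [mem_ball_zero_iff, imagParam, norm_mul, Complex.norm_I, mul_one, Complex.norm_real,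
    Real.norm_eq_abs, abs_neg, abs_mul, hε, one_mul, abs_of_nonneg ht]
  exact htρ

theorem sideGap_imagParam {ε : ℝ} (hε : ε * ε = 1) (t : ℝ) (z : ℂ) :
    sideGap ε (-(ε * (imagParam ε t).im)) z = sideGap ε t z := by
  rw [imagParam_im]
  congr 1
  linear_combination t * hε

theorem zero_mem_scalingDomain {ρ ε : ℝ} (hρ : 0 < ρ) {z : ℂ} (hz : 0 < ε * z.im) :
    (0 : ℂ) ∈ scalingDomain ρ ε z :=
  ⟨by simpa using hρ, by simpa [sideGap] using hz⟩

theorem imagParam_mem_scalingDomain {ρ ε t : ℝ} (hρ : ρ ≤ Real.pi / 8) (hε : |ε| = 1)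
    (ht : 0 < t) (htρ : t < ρ) {z : ℂ} (hz : 0 < discGap z) (him : 0 ≤ ε * z.im) :
    imagParam ε t ∈ scalingDomain ρ ε z := by
  refine ⟨imagParam_mem_ball hε ht.le htρ, ?_⟩
  change 0 < sideGap _ _ _
  rw [sideGap_imagParam (by rw [← abs_mul_abs_self, hε, one_mul])]
  exact sideGap_pos ht (htρ.trans_le hρ) hz him

theorem expSeries_innerSL {H : Type*} [NormedAddCommGroup H] [InnerProductSpace ℂ H]
    [CompleteSpace H] {v : ℕ → H} {r : ℝ}
    (hv : Summable fun k : ℕ => r ^ k / (k.factorial : ℝ) * ‖v k‖) {θ : ℂ} (hθ : ‖θ‖ ≤ r) :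
    expSeries (fun k => innerSL ℂ (v k)) ((starRingEnd ℂ) θ) = innerSL ℂ (expSeries v θ) := by
  have h := (hasSum_expSeries hv hθ).mapL (innerSL ℂ)
  rw [← h.tsum_eq, expSeries]
  congr 1
  funext k
  rw [map_smulₛₗ]
  simp

namespace IsScalingFamily

variable {U : ℝ → EllTwo →L[ℂ] EllTwo} {V : EllTwo →L[ℂ] EllTwo}
  {F : ℂ → EllTwo →L[ℂ] EllTwo} {ρ ε : ℝ}

/-- For a small imaginary scaling parameter, `z - H(θ)` is invertible at some point of the region
reached by analytic continuation. -/
theorem exists_isUnit_sub_scaledH (hF : IsScalingFamily U V F ρ) (hε : |ε| = 1) :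
    ∃ t : ℝ, 0 < t ∧ t < ρ ∧ ∃ z : ℂ, 0 < sideGap ε t z ∧
      IsUnit (algebraMap ℂ (EllTwo →L[ℂ] EllTwo) z - scaledH F (imagParam ε t)) := by
  have hεε : ε * ε = 1 := by rw [← abs_mul_abs_self, hε, one_mul]
  let N : ℝ := ‖H0 + V‖ * ‖(1 : EllTwo →L[ℂ] EllTwo)‖ + 1
  have hN : 0 < N := by positivity
  let z : ℂ := ((ε * N : ℝ) : ℂ) * Complex.I
  have hzn : ‖z‖ = N := by
    rw [norm_mul, Complex.norm_I, mul_one, Complex.norm_real, Real.norm_eq_abs, abs_mul, hε,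
      one_mul, abs_of_pos hN]
  have hzim : ε * z.im = N := by
    have : z.im = ε * N := by simp [z]
    rw [this, ← mul_assoc, hεε, one_mul]
  have hres : IsUnit (algebraMap ℂ (EllTwo →L[ℂ] EllTwo) z - scaledH F (imagParam ε 0)) := by
    have : imagParam ε 0 = 0 := by simp [imagParam]
    rw [this, hF.scaledH_zero]
    refine spectrum.mem_resolventSet_of_norm_lt_mul ?_
    rw [hzn]
    exact lt_add_one _
  have hp : ContinuousAt (imagParam ε) 0 := by
    unfold imagParam
    fun_prop
  have hball : imagParam ε 0 ∈ Metric.ball (0 : ℂ) ρ := imagParam_mem_ball hε le_rfl hF.radius_pos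
  have hcont : ContinuousAt (fun t => algebraMap ℂ (EllTwo →L[ℂ] EllTwo) z -
      scaledH F (imagParam ε t)) 0 :=
    continuousAt_const.sub (((hF.differentiableOn_scaledH.differentiableAt
      (Metric.isOpen_ball.mem_nhds hball)).continuousAt).comp hp)
  have h1 := hcont.eventually (Units.isOpen.mem_nhds hres)
  have h2 : ∀ᶠ t in 𝓝 (0 : ℝ), 0 < sideGap ε t z := by
    have hc : ContinuousAt (fun t => sideGap ε t z) 0 := by
      unfold sideGap
      fun_prop
    refine continuousAt_const.eventually_lt hc ?_
    simpa [sideGap, hzim] using hN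
  have h3 : ∀ᶠ t in 𝓝[>] (0 : ℝ), t ∈ Ioo 0 ρ := Ioo_mem_nhdsGT hF.radius_pos
  obtain ⟨t, ⟨ht1, ht2⟩, ht3⟩ := (((h1.and h2).filter_mono nhdsWithin_le_nhds).and h3).exists
  exact ⟨t, ht3.1, ht3.2, z, ht2, ht1⟩

/-- The points of `(0, 4)` at which `z - H(θ)` is not invertible, for a suitable imaginary `θ`, do
not accumulate in `(0, 4)`. -/
theorem exists_eventually_isUnit (hF : IsScalingFamily U V F ρ) (hε : |ε| = 1) :
    ∃ t : ℝ, 0 < t ∧ t < ρ ∧ ∀ x ∈ Ioo (0 : ℝ) 4, ∀ᶠ y : ℝ in 𝓝[≠] x,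
      IsUnit (algebraMap ℂ (EllTwo →L[ℂ] EllTwo) y - scaledH F (imagParam ε t)) := by
  have hεε : ε * ε = 1 := by rw [← abs_mul_abs_self, hε, one_mul]
  obtain ⟨t, ht0, htρ, z, hz, hzu⟩ := hF.exists_isUnit_sub_scaledH hε
  refine ⟨t, ht0, htρ, fun x hx => ?_⟩
  have hball := imagParam_mem_ball hε ht0.le htρ
  have hopen : IsOpen {z : ℂ | 0 < sideGap ε t z} := by
    refine isOpen_lt continuous_const ?_
    have := continuous_discGap
    unfold sideGap
    fun_prop
  have hxmem : 0 < sideGap ε t (x : ℂ) :=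
    sideGap_pos ht0 (htρ.trans_le hF.radius_le) (discGap_ofReal_pos hx) (by simp)
  have h := eventually_isUnit_sub_of_isPreconnected hopen
    (convex_setOf_sideGap_pos ε ht0.le (htρ.trans_le hF.radius_le)).isPreconnected
    (A := fun z => algebraMap ℂ (EllTwo →L[ℂ] EllTwo) z - scaledH0 (imagParam ε t))
    (K := fun _ => F (imagParam ε t))
    (fun w _ => by
      simp only [Algebra.algebraMap_eq_smul_one]
      fun_prop)
    (fun w hw => isUnit_sub_scaledH0_of_mem hF.radius_le hεε hball (by
      rw [sideGap_imagParam hεε]; exact hw))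
    (differentiableOn_const _) (fun _ _ => hF.isCompactOperator hball) hz
    (by rwa [sub_sub]) hxmem
  have htend : Tendsto (fun y : ℝ => (y : ℂ)) (𝓝[≠] x) (𝓝[≠] (x : ℂ)) :=
    tendsto_nhdsWithin_iff.2 ⟨Complex.continuous_ofReal.continuousAt.tendsto.mono_left
      nhdsWithin_le_nhds, eventually_mem_nhdsWithin.mono fun y hy => by simpa using hy⟩
  filter_upwards [htend.eventually h] with y hy
  rwa [sub_sub] at hy

/-- A matrix element of the resolvent between analytic vectors equals a matrix element of the
resolvent of the scaled Hamiltonian, for an imaginary scaling parameter within the radius of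
convergence of the exponential series of the vectors. -/
theorem inner_resolvent_eq (hF : IsScalingFamily U V F ρ) (hε : |ε| = 1) {v u : ℕ → EllTwo}
    (hv : ∀ k, (v k, v (k + 1)) ∈ A0.graph) (hu : ∀ k, (u k, u (k + 1)) ∈ A0.graph) {r t : ℝ}
    (hvr : Summable fun k : ℕ => r ^ k / (k.factorial : ℝ) * ‖v k‖)
    (hur : Summable fun k : ℕ => r ^ k / (k.factorial : ℝ) * ‖u k‖)
    (ht : 0 < t) (htρ : t < ρ) (htr : t < r) {z : ℂ} (hz : 0 < discGap z) (him : 0 < ε * z.im)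
    (hzu : z ∈ resolventSet ℂ (H0 + V)) :
    inner ℂ (v 0) (resolvent (H0 + V) z (u 0)) =
      expSeries (fun k => innerSL ℂ (v k)) (-Complex.I * imagParam ε t)
        (Ring.inverse (algebraMap ℂ (EllTwo →L[ℂ] EllTwo) z - scaledH F (imagParam ε t))
          (expSeries u (Complex.I * imagParam ε t))) := by
  have hεε : ε * ε = 1 := by rw [← abs_mul_abs_self, hε, one_mul]
  have hr : 0 < r := ht.trans htr
  let T : ℂ → EllTwo →L[ℂ] EllTwo := fun θ =>
    algebraMap ℂ (EllTwo →L[ℂ] EllTwo) z - scaledH F θ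
  let S : Set ℂ := scalingDomain ρ ε z ∩ Metric.ball 0 r
  have hS : IsOpen S := (isOpen_scalingDomain ρ ε z).inter Metric.isOpen_ball
  have hconv : Convex ℝ S :=
    (convex_scalingDomain hF.radius_le hε hz him.le).inter (convex_ball 0 r)
  have h0 : (0 : ℂ) ∈ scalingDomain ρ ε z := zero_mem_scalingDomain hF.radius_pos him
  have h0S : ((0 : ℝ) : ℂ) ∈ S := ⟨by simpa using h0, by simpa using hr⟩
  have hTu : ∀ θ ∈ S, IsUnit (T θ) := fun θ hθ =>
    hF.isUnit_sub_scaledH_of_mem hεε hz him.le h0 hθ.1 (by rw [hF.scaledH_zero]; exact hzu)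
  have hT : DifferentiableOn ℂ (fun θ => Ring.inverse (T θ)) S := fun θ hθ =>
    ((differentiableAt_inverse (hTu θ hθ)).comp θ ((hF.differentiableOn_scaledH.differentiableAt
      (Metric.isOpen_ball.mem_nhds hθ.1.1)).const_sub _)).differentiableWithinAt
  have hv' : Summable fun k : ℕ => r ^ k / (k.factorial : ℝ) * ‖innerSL ℂ (v k)‖ := by
    simpa only [innerSL_apply_norm] using hvr
  have hdv : DifferentiableOn ℂ
      (fun θ => expSeries (fun k => innerSL ℂ (v k)) (-Complex.I * θ)) S :=
    (differentiableOn_expSeries hv').comp (by fun_prop) fun θ hθ => by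
      simpa using hθ.2
  have hdu : DifferentiableOn ℂ (fun θ => expSeries u (Complex.I * θ)) S :=
    (differentiableOn_expSeries hur).comp (by fun_prop) fun θ hθ => by
      simpa using hθ.2
  refine eqOn_of_eventuallyEq_ofReal hS hconv.isPreconnected
    (f := fun _ => (inner ℂ (v 0) (resolvent (H0 + V) z (u 0)) : ℂ))
    (g := fun θ => expSeries (fun k => innerSL ℂ (v k)) (-Complex.I * θ)
      (Ring.inverse (T θ) (expSeries u (Complex.I * θ)))) (differentiableOn_const _)
    (hdv.clm_apply (hT.clm_apply hdu)) h0S ?_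
    ⟨imagParam_mem_scalingDomain hF.radius_le hε ht htρ hz him.le,
      imagParam_mem_ball hε ht.le htr⟩
  have hnear : ∀ᶠ x : ℝ in 𝓝[>] 0, (x : ℂ) ∈ S :=
    (Complex.continuous_ofReal.continuousAt.eventually (hS.mem_nhds h0S)).filter_mono
      nhdsWithin_le_nhds
  filter_upwards [hnear, eventually_mem_nhdsWithin] with x hx hx0
  have hx0 : 0 < x := hx0
  have hxρ : |x| < ρ := by simpa using hx.1.1
  have hxr : |x| < r := by simpa using hx.2
  have hxr' : x ≤ r := (le_abs_self x).trans hxr.le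
  have e1 : -Complex.I * (x : ℂ) = (starRingEnd ℂ) (Complex.I * x) := by simp
  have e2 : Ring.inverse (T x) = U x * resolvent (H0 + V) z * U (-x) := by
    have hinv : T x * (U x * resolvent (H0 + V) z * U (-x)) = 1 := by
      have : T x = U x * (algebraMap ℂ (EllTwo →L[ℂ] EllTwo) z - (H0 + V)) * U (-x) := by
        simp only [T]
        rw [hF.scaledH_ofReal hxρ, mul_sub, sub_mul, ← Algebra.commutes z (U x),
          mul_assoc _ (U x) (U (-x)), hF.group.mul_neg, mul_one]
      rw [this, ← mul_assoc, ← mul_assoc, mul_assoc _ (U (-x)) (U x), hF.group.neg_mul, mul_one,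
        mul_assoc (U x), resolvent, Ring.mul_inverse_cancel _ hzu, mul_one, hF.group.mul_neg]
    rw [← Ring.inverse_mul_cancel_left _ (U x * resolvent (H0 + V) z * U (-x)) (hTu x hx), hinv,
      mul_one]
  rw [e1, expSeries_innerSL hvr (by simpa using hxr.le), e2,
    ← hF.group.apply_eq_expSeries hv hvr hx0.le hxr',
    ← hF.group.apply_eq_expSeries hu hur hx0.le hxr', innerSL_apply_apply]
  simp only [mul_apply_eq_comp]
  rw [hF.group.neg_apply_apply, hF.group.inner_apply]

/-- The limiting absorption principle on one side of the real axis, away from the exceptional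
points. -/
theorem exists_bound (hF : IsScalingFamily U V F ρ) (hε : |ε| = 1) {t : ℝ} (ht : 0 < t)
    (htρ : t < ρ) {K : Set ℝ} (hK : IsCompact K) (hK4 : K ⊆ Ioo 0 4)
    (hKu : ∀ x ∈ K, IsUnit (algebraMap ℂ (EllTwo →L[ℂ] EllTwo) (x : ℂ) -
      scaledH F (imagParam ε t))) :
    ∃ δ : ℝ, 0 < δ ∧ (∀ z : ℂ, z.re ∈ K → ε * z.im ∈ Ioo 0 δ → z ∈ resolventSet ℂ (H0 + V)) ∧
      ∀ φ ψ : EllTwo, IsAnalyticVector A0 φ → IsAnalyticVector A0 ψ → ∃ M : ℝ, ∀ z : ℂ,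
        z.re ∈ K → ε * z.im ∈ Ioo 0 δ → ‖inner ℂ φ (resolvent (H0 + V) z ψ)‖ ≤ M := by
  have hεε : ε * ε = 1 := by rw [← abs_mul_abs_self, hε, one_mul]
  let G : Set ℂ := {z | 0 < discGap z} ∩
    {z | IsUnit (algebraMap ℂ (EllTwo →L[ℂ] EllTwo) z - scaledH F (imagParam ε t))}
  have hG : IsOpen G := by
    refine (isOpen_lt continuous_const continuous_discGap).inter (Units.isOpen.preimage ?_)
    simp only [Algebra.algebraMap_eq_smul_one]
    fun_prop
  obtain ⟨δ, hδ, hδG⟩ := (hK.image Complex.continuous_ofReal).exists_thickening_subset_open hG (by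
    rintro _ ⟨x, hx, rfl⟩
    exact ⟨discGap_ofReal_pos (hK4 hx), hKu x hx⟩)
  have hmem : ∀ z : ℂ, z.re ∈ K → ε * z.im ∈ Icc 0 (δ / 2) → z ∈ G := fun z hz him => by
    refine hδG (Metric.mem_thickening_iff.2 ⟨(z.re : ℂ), ⟨z.re, hz, rfl⟩, ?_⟩)
    have e : z - (z.re : ℂ) = (z.im : ℂ) * Complex.I := by
      apply Complex.ext <;> simp
    rw [dist_eq_norm, e, norm_mul, Complex.norm_I, mul_one, Complex.norm_real, Real.norm_eq_abs,
      ← one_mul |z.im|, ← hε, ← abs_mul, abs_of_nonneg him.1]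
    linarith [him.2]
  have hunit : ∀ z : ℂ, z.re ∈ K → ε * z.im ∈ Icc 0 (δ / 2) → ∀ θ ∈ scalingDomain ρ ε z,
      IsUnit (algebraMap ℂ (EllTwo →L[ℂ] EllTwo) z - scaledH F θ) := fun z hz him θ hθ =>
    hF.isUnit_sub_scaledH_of_mem hεε (hmem z hz him).1 him.1
      (imagParam_mem_scalingDomain hF.radius_le hε ht htρ (hmem z hz him).1 him.1) hθ
      (hmem z hz him).2
  have hres : ∀ z : ℂ, z.re ∈ K → ε * z.im ∈ Ioo 0 (δ / 2) → z ∈ resolventSet ℂ (H0 + V) :=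
    fun z hz him => by
      have := hunit z hz (Ioo_subset_Icc_self him) 0 (zero_mem_scalingDomain hF.radius_pos him.1)
      rwa [hF.scaledH_zero] at this
  refine ⟨δ / 2, half_pos hδ, hres, ?_⟩
  rintro φ ψ ⟨v, rfl, hv, r₁, hr₁, hvr⟩ ⟨u, rfl, hu, r₂, hr₂, hur⟩
  let r := min r₁ r₂
  have hr : 0 < r := lt_min hr₁ hr₂
  have hmono : ∀ {w : ℕ → EllTwo} {R : ℝ}, r ≤ R →
      (Summable fun k : ℕ => R ^ k / (k.factorial : ℝ) * ‖w k‖) →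
      Summable fun k : ℕ => r ^ k / (k.factorial : ℝ) * ‖w k‖ := fun hR hw =>
    hw.of_nonneg_of_le (fun k => by positivity) fun k => by gcongr
  obtain ⟨s, hs0, hs⟩ := exists_between (lt_min hF.radius_pos hr)
  have hsρ := hs.trans_le (min_le_left _ _)
  have hsr := hs.trans_le (min_le_right _ _)
  let Q : Set ℂ := K ×ℂ ((fun y => ε * y) '' Icc 0 (δ / 2))
  have hQ : IsCompact Q := hK.reProdIm (isCompact_Icc.image (by fun_prop))
  have hQmem : ∀ z ∈ Q, z.re ∈ K ∧ ε * z.im ∈ Icc 0 (δ / 2) := by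
    rintro z ⟨h1, y, hy, h2⟩
    refine ⟨h1, ?_⟩
    rw [← h2, ← mul_assoc, hεε, one_mul]
    exact hy
  have hcont : ContinuousOn (fun z : ℂ => Ring.inverse
      (algebraMap ℂ (EllTwo →L[ℂ] EllTwo) z - scaledH F (imagParam ε s))) Q := fun z hz => by
    obtain ⟨h1, h2⟩ := hQmem z hz
    have hu := hunit z h1 h2 _ (imagParam_mem_scalingDomain hF.radius_le hε hs0 hsρ
      (hmem z h1 h2).1 h2.1)
    have hc : ContinuousAt (fun z : ℂ => algebraMap ℂ (EllTwo →L[ℂ] EllTwo) z -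
        scaledH F (imagParam ε s)) z := by
      simp only [Algebra.algebraMap_eq_smul_one]
      fun_prop
    exact (ContinuousAt.comp (f := fun z : ℂ => algebraMap ℂ (EllTwo →L[ℂ] EllTwo) z -
        scaledH F (imagParam ε s)) (differentiableAt_inverse (𝕜 := ℂ) hu).continuousAt
        hc).continuousWithinAt
  obtain ⟨M, hM⟩ := hQ.exists_bound_of_continuousOn hcont
  refine ⟨‖expSeries (fun k => innerSL ℂ (v k)) (-Complex.I * imagParam ε s)‖ *
    (M * ‖expSeries u (Complex.I * imagParam ε s)‖), fun z hz him => ?_⟩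
  have hzQ : z ∈ Q := ⟨hz, ε * z.im, Ioo_subset_Icc_self him, by
    beta_reduce
    rw [← mul_assoc, hεε, one_mul]⟩
  rw [hF.inner_resolvent_eq hε hv hu (hmono (min_le_left _ _) hvr) (hmono (min_le_right _ _) hur)
    hs0 hsρ hsr (hmem z hz (Ioo_subset_Icc_self him)).1 him.1 (hres z hz him)]
  refine (ContinuousLinearMap.le_opNorm _ _).trans ?_
  gcongr
  exact ContinuousLinearMap.le_of_opNorm_le _ (hM z hzQ) _

end IsScalingFamily

end DiscreteSchrodinger

theorem theorem3
    (V : DiscreteSchrodinger.EllTwo →L[ℂ] DiscreteSchrodinger.EllTwo)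
    (hV : IsCompactOperator V)
    (hVA : DiscreteSchrodinger.MemScalingClass DiscreteSchrodinger.A0 V) :
    ∃ D : Set ℝ, D ⊆ Set.Ioo 0 4 ∧ IsDiscrete D ∧
      (∀ x : ℝ, AccPt x (Filter.principal D) → x = 0 ∨ x = 4) ∧
      ∀ Δ₀ : Set ℝ, Δ₀.OrdConnected → closure Δ₀ ⊆ Set.Ioo 0 4 \ D →
        ∃ δ₀ : ℝ, 0 < δ₀ ∧
          Δ₀ ×ℂ Set.Ioo (-δ₀) 0 ⊆ resolventSet ℂ (DiscreteSchrodinger.H0 + V) ∧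
          Δ₀ ×ℂ Set.Ioo 0 δ₀ ⊆ resolventSet ℂ (DiscreteSchrodinger.H0 + V) ∧
          ∀ φ ψ : DiscreteSchrodinger.EllTwo,
            DiscreteSchrodinger.IsAnalyticVector DiscreteSchrodinger.A0 φ →
            DiscreteSchrodinger.IsAnalyticVector DiscreteSchrodinger.A0 ψ →
            BddAbove ((fun z : ℂ => ‖inner ℂ φ (resolvent (DiscreteSchrodinger.H0 + V) z ψ)‖) ''
              (Δ₀ ×ℂ Set.Ioo (-δ₀) 0)) ∧
            BddAbove ((fun z : ℂ => ‖inner ℂ φ (resolvent (DiscreteSchrodinger.H0 + V) z ψ)‖) ''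
              (Δ₀ ×ℂ Set.Ioo 0 δ₀)) := by
  open DiscreteSchrodinger in
  obtain ⟨U, F, ρ, hF⟩ := MemScalingClass.exists_isScalingFamily hV hVA
  have hε₁ : |(1 : ℝ)| = 1 := abs_one
  have hε₂ : |(-1 : ℝ)| = 1 := by simp
  obtain ⟨t₁, ht₁, htρ₁, hu₁⟩ := hF.exists_eventually_isUnit hε₁
  obtain ⟨t₂, ht₂, htρ₂, hu₂⟩ := hF.exists_eventually_isUnit hε₂
  let D : Set ℝ := {x | x ∈ Ioo (0 : ℝ) 4 ∧
    ¬ (IsUnit (algebraMap ℂ (EllTwo →L[ℂ] EllTwo) (x : ℂ) - scaledH F (imagParam 1 t₁)) ∧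
      IsUnit (algebraMap ℂ (EllTwo →L[ℂ] EllTwo) (x : ℂ) - scaledH F (imagParam (-1) t₂)))}
  have hD : ∀ x ∈ Ioo (0 : ℝ) 4, ∀ᶠ y in 𝓝[≠] x, y ∉ D := fun x hx => by
    filter_upwards [hu₁ x hx, hu₂ x hx] with y hy₁ hy₂ hyD
    exact hyD.2 ⟨hy₁, hy₂⟩
  refine ⟨D, fun x hx => hx.1, ?_, fun x hx => ?_, fun Δ₀ _ hΔ => ?_⟩
  · rw [isDiscrete_iff_nhdsNE]
    intro x hx
    exact (Filter.disjoint_principal_right.2 (hD x hx.1)).eq_bot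
  · rw [accPt_iff_frequently_nhdsNE] at hx
    have hcl : x ∈ Icc (0 : ℝ) 4 := by
      have h1 : x ∈ closure D := mem_closure_iff_frequently.2 (hx.filter_mono nhdsWithin_le_nhds)
      exact closure_minimal (fun y hy => Ioo_subset_Icc_self hy.1) isClosed_Icc h1
    by_contra! hne
    exact hx (hD x ⟨lt_of_le_of_ne hcl.1 hne.1.symm, lt_of_le_of_ne hcl.2 hne.2⟩)
  · have hsub : closure Δ₀ ⊆ Ioo 0 4 := fun x hx => (hΔ hx).1
    have hK : IsCompact (closure Δ₀) :=
      isCompact_Icc.of_isClosed_subset isClosed_closure (hsub.trans Ioo_subset_Icc_self)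
    have hun : ∀ x ∈ closure Δ₀,
        IsUnit (algebraMap ℂ (EllTwo →L[ℂ] EllTwo) (x : ℂ) - scaledH F (imagParam 1 t₁)) ∧
        IsUnit (algebraMap ℂ (EllTwo →L[ℂ] EllTwo) (x : ℂ) - scaledH F (imagParam (-1) t₂)) :=
      fun x hx => by_contra fun h => (hΔ hx).2 ⟨(hΔ hx).1, h⟩
    obtain ⟨δ₁, hδ₁, hr₁, hb₁⟩ :=
      hF.exists_bound hε₁ ht₁ htρ₁ hK hsub fun x hx => (hun x hx).1
    obtain ⟨δ₂, hδ₂, hr₂, hb₂⟩ :=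
      hF.exists_bound hε₂ ht₂ htρ₂ hK hsub fun x hx => (hun x hx).2
    have hup : ∀ z ∈ Δ₀ ×ℂ Ioo 0 (min δ₁ δ₂), z.re ∈ closure Δ₀ ∧ 1 * z.im ∈ Ioo 0 δ₁ :=
      fun z hz => ⟨subset_closure hz.1, by
        rw [one_mul]; exact ⟨hz.2.1, hz.2.2.trans_le (min_le_left _ _)⟩⟩
    have hlow : ∀ z ∈ Δ₀ ×ℂ Ioo (-min δ₁ δ₂) 0, z.re ∈ closure Δ₀ ∧ -1 * z.im ∈ Ioo 0 δ₂ :=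
      fun z hz => ⟨subset_closure hz.1, by
        have h1 : -min δ₁ δ₂ < z.im := hz.2.1
        have h2 : z.im < 0 := hz.2.2
        exact ⟨by linarith, by linarith [min_le_right δ₁ δ₂]⟩⟩
    refine ⟨min δ₁ δ₂, lt_min hδ₁ hδ₂, fun z hz => hr₂ z (hlow z hz).1 (hlow z hz).2,
      fun z hz => hr₁ z (hup z hz).1 (hup z hz).2, fun φ ψ hφ hψ => ⟨?_, ?_⟩⟩
    · obtain ⟨M, hM⟩ := hb₂ φ ψ hφ hψ
      refine ⟨M, ?_⟩
      rintro _ ⟨z, hz, rfl⟩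
      exact hM z (hlow z hz).1 (hlow z hz).2
    · obtain ⟨M, hM⟩ := hb₁ φ ψ hφ hψ
      refine ⟨M, ?_⟩
      rintro _ ⟨z, hz, rfl⟩
      exact hM z (hup z hz).1 (hup z hz).2
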